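/- Let $\tilde W=\langle s_0,s_1\mid s_0^2=s_1^2=1\rangle$ be the affine Weyl group of $\mathrm{SL}_2$ (the infinite dihedral group), with length $\ell$ and Bruhat order $\le$. Let $H$ be its Iwahori--Hecke algebra over $\mathbb Z[q^{\pm 1/2}]$, with basis $T_w$ and relations $T_wT_{w'}=T_{ww'}$ if $\ell(ww')=\ell(w)+\ell(w')$ and $(T_s+1)(T_s-q)=0$ for $s\in\{s_0,s_1\}$. Let $$C_w=\sum_{y\le w}(-1)^{\ell(w)-\ell(y)}q^{\frac{\ell(w)}2-\ell(y)}T_y$$ be the Kazhdan--Lusztig basis, with structure constants $C_xC_y=\sum_z h_{x,y,z}C_z$; let $j(\sum_w a_wT_w)=\sum_w\overline{a_w}(-1)^{\ell(w)}q^{-\ell(w)}T_w$, where $\overline{q^{1/2}}=q^{-1/2}$, and $C'_w=(-1)^{\ell(w)}j(C_w)$. Let $a(z)$ be Lusztig's function, the least integer $n\ge 0$ such that $(-q^{1/2})^nh_{x,y,z}\in\mathbb Z[q^{1/2}]$ for all $x,y$, and let $\mathcal D=\{1,s_0,s_1\}$. Let $J$ be Lusztig's asymptotic Hecke algebra with basis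 $\{t_w\}_{w\in\tilde W}$. Consider the completion of $H$ consisting of the sums $\sum_x a_xC'_x$ with $a_x\in\mathbb Z((q^{-1/2}))$ and $a_x\to0$ (for every $N$, $a_x\in q^{-N/2}\,\mathbb Z[[q^{-1/2}]]$ once $\ell(x)$ is large); $j$ extends to it by $j(\sum_x a_xC'_x)=\sum_x\overline{a_x}(-1)^{\ell(x)}C_x$, and $$\phi\Big(\sum_x b_xC_x\Big)=\sum_{x,z\in\tilde W}\ \sum_{d\in\mathcal D,\ a(d)=a(z)}b_xh_{x,d,z}\,t_z .$$ Let $F$ be a non-archimedean local field with ring of integers $\mathcal O$, uniformizer $\pi$, residue field of cardinality $q$ and normalized absolute value $|\cdot|$. Put $K=\mathrm{SL}_2(\mathcal O)$, let $I\subset K$ be the Iwahori subgroup of matrices that are upper triangular modulo $\pi$, and identify $\tilde W$ with $N(A)(F)/A(\mathcal O)$, where $A$ is the diagonal torus, so that $s_0$ is the class of $\begin{pmatrix}0&-1\\1&0\end{pmatrix}$ and $s_0s_1$ is the class of $\mathrm{diag}(\pi,\pi^{-1})$. For $g\in K\,\mathrm{diag}(\pi^n,\pi^{-n})K$ with $n\ge0$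 put $\Delta(g)=q^n$. The Harish-Chandra Schwartz space $\mathcal C$ of $\mathrm{SL}_2(F)$ consists of the functions $f\colon\mathrm{SL}_2(F)\to\mathbb C$ that are bi-invariant under some open compact subgroup and such that for every polynomial function $p\colon \mathrm{SL}_2(F)\to F$ and every $m>0$ there is a constant $C$ with $\Delta(g)\,|f(g)|\,(\log(1+|p(g)|))^m\le C$ for all $g$. **Proposition.** For every $y\in\tilde W$ there is a unique element of the completion of $H$, again denoted $t_y$, whose image under $\phi\circ j$ is $t_y\in J$. Write $t_y=\sum_w b_{y,w}T_w$; the coefficients $b_{y,w}$ are series in $q^{-1/2}$ which converge when $q$ is the cardinality of the residue field. There is a unique function on $\mathrm{SL}_2(F)$ whose value on each double coset $IwI$ is $b_{y,w}$. This function is bi-invariant under $I$ and lies in $\mathcal C$. Moreover, if $y\ne1$ has reduced expression $s_{i_1}\cdots s_{i_n}$ and $y_k=s_{i_1}\cdots s_{i_k}$, then $b_{y,w}=-q^{\frac{n-1}2}\sum_{k=1}^nq^{k-n}c_k(w)$, where $c_k(w)=\frac{(-1)^{\ell(w)}q^{-\ell(w)+1}}{1+q}$ if $w$ starts with $y_k$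 (that is, $\ell(w)=\ell(y_k)+\ell(y_k^{-1}w)$), and otherwise $c_k(w)=\frac{(-1)^{\ell(w)+1}q^{-\ell(w)}}{1+q}$ if $\ell(w)\ge k$ and $c_k(w)=\frac{(-1)^kq^{-k+1}}{1+q}$ if $\ell(w)<k$. -/

import Mathlib

open Matrix ValuativeRel
open scoped MatrixGroups

noncomputable section

namespace AsymptoticHecke

/-! ### The affine Weyl group of `SL₂` -/

/-- The affine Weyl group `W ⋉ X_*(A)` of `SL₂`, i.e. the infinite dihedral group: `r n` is the
translation `π^n` by `n α^∨`, and `sr n` is `s_α π^n`. -/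
abbrev AffineWeyl : Type := DihedralGroup 0

/-- The simple reflections: `s₀ = s_α` and the affine reflection `s₁ = s_α π`. -/
def gen : Fin 2 → AffineWeyl
  | 0 => .sr 0
  | 1 => .sr 1

/-- The element of the affine Weyl group represented by a word in the simple reflections. -/
def wordProd (ω : List (Fin 2)) : AffineWeyl := (ω.map gen).prod

theorem wordProd_append (ω ω' : List (Fin 2)) :
    wordProd (ω ++ ω') = wordProd ω * wordProd ω' := by
  simp [wordProd]

theorem exists_word_r_nat (n : ℕ) : ∃ ω, wordProd ω = .r ((n : ℤ) : ZMod 0) := by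
  induction n with
  | zero => exact ⟨[], rfl⟩
  | succ k ih =>
    obtain ⟨ω, hω⟩ := ih
    refine ⟨ω ++ [0, 1], ?_⟩
    rw [wordProd_append, hω]
    refine congrArg (fun m : ℤ => (DihedralGroup.r m : AffineWeyl)) ?_
    change (k : ℤ) + (1 - 0) = ((k + 1 : ℕ) : ℤ)
    push_cast
    ring

theorem exists_word_r_neg (n : ℕ) : ∃ ω, wordProd ω = .r ((-(n : ℤ) : ℤ) : ZMod 0) := by
  induction n with
  | zero => exact ⟨[], rfl⟩
  | succ k ih =>
    obtain ⟨ω, hω⟩ := ih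
    refine ⟨ω ++ [1, 0], ?_⟩
    rw [wordProd_append, hω]
    refine congrArg (fun m : ℤ => (DihedralGroup.r m : AffineWeyl)) ?_
    change -(k : ℤ) + (0 - 1) = -((k + 1 : ℕ) : ℤ)
    push_cast
    ring

theorem exists_word_r (n : ℤ) : ∃ ω, wordProd ω = .r (n : ZMod 0) := by
  obtain ⟨k, rfl | rfl⟩ := n.eq_nat_or_neg
  · exact exists_word_r_nat k
  · exact exists_word_r_neg k

theorem exists_word (w : AffineWeyl) : ∃ ω, wordProd ω = w := by
  rcases w with n | n
  · exact exists_word_r n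
  · obtain ⟨ω, hω⟩ := exists_word_r n
    refine ⟨[0] ++ ω, ?_⟩
    rw [wordProd_append, hω]
    simp [wordProd, gen]

/-- The length function: the least length of a word representing `w`. -/
def len (w : AffineWeyl) : ℕ := sInf {n | ∃ ω, ω.length = n ∧ wordProd ω = w}

theorem exists_reduced (w : AffineWeyl) : ∃ ω, ω.length = len w ∧ wordProd ω = w := by
  obtain ⟨ω, hω⟩ := exists_word w
  exact Nat.sInf_mem (s := {n | ∃ ω, ω.length = n ∧ wordProd ω = w}) ⟨_, ω, rfl, hω⟩

theorem len_wordProd_le (ω : List (Fin 2)) : len (wordProd ω) ≤ ω.length :=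
  Nat.sInf_le ⟨ω, rfl, rfl⟩

/-- The (unique) reduced word of `w`. -/
def redWord (w : AffineWeyl) : List (Fin 2) := (exists_reduced w).choose

theorem redWord_length (w : AffineWeyl) : (redWord w).length = len w :=
  (exists_reduced w).choose_spec.1

theorem wordProd_redWord (w : AffineWeyl) : wordProd (redWord w) = w :=
  (exists_reduced w).choose_spec.2

/-- The Bruhat interval `{y | y ≤ w}`: the elements represented by the words obtained from the
reduced word of `w` by deleting some letters. -/
def lower (w : AffineWeyl) : Finset AffineWeyl := ((redWord w).sublists.map wordProd).toFinset

theorem mem_lower {w y : AffineWeyl} :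
    y ∈ lower w ↔ ∃ ω, ω.Sublist (redWord w) ∧ wordProd ω = y := by
  simp [lower]

theorem self_mem_lower (w : AffineWeyl) : w ∈ lower w :=
  mem_lower.2 ⟨_, List.Sublist.refl _, wordProd_redWord w⟩

theorem len_lt_of_mem_lower {w y : AffineWeyl} (h : y ∈ lower w) (hne : y ≠ w) :
    len y < len w := by
  obtain ⟨ω, hω, rfl⟩ := mem_lower.1 h
  have h1 := len_wordProd_le ω
  have h2 := hω.length_le
  rw [redWord_length] at h2
  rcases (h1.trans h2).lt_or_eq with h3 | h3
  · exact h3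
  · exfalso
    apply hne
    rw [hω.eq_of_length (by rw [redWord_length]; omega), wordProd_redWord]

/-- `w` starts with `y`: a reduced expression of `y` followed by further letters is a reduced
expression of `w`. -/
def StartsWith (w y : AffineWeyl) : Prop := len w = len y + len (y⁻¹ * w)

/-! ### The Iwahori-Hecke algebra -/

/-- The ring `ℤ[q^{1/2}, q^{-1/2}]`; the variable `T` is `q^{1/2}`, so `q^{n/2}` is `T n`. -/
abbrev Coeff : Type := LaurentPolynomial ℤ

/-- `qHalf n = q^{n/2}`. -/
abbrev qHalf (n : ℤ) : Coeff := LaurentPolynomial.T n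

/-- The Iwahori-Hecke algebra `H`, free over `ℤ[q^{1/2}, q^{-1/2}]` on the basis
`T_w = single w 1`. -/
abbrev Hecke : Type := AffineWeyl →₀ Coeff

/-- Right multiplication by `T_s` for a simple reflection `s`: `T_w T_s = T_{ws}` if
`ℓ(ws) > ℓ(w)`, and `T_w T_s = (q - 1) T_w + q T_{ws}` otherwise. -/
def mulGen (s : Fin 2) : Hecke →ₗ[Coeff] Hecke :=
  Finsupp.linearCombination Coeff fun w =>
    if len w < len (w * gen s) then Finsupp.single (w * gen s) 1
    else Finsupp.single w (qHalf 2 - 1) + Finsupp.single (w * gen s) (qHalf 2)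

/-- The product of `H`: right multiplication by `T_y` is successive right multiplication by the
`T_s` along the reduced word of `y`. -/
def mul (a b : Hecke) : Hecke :=
  b.sum fun y c => c • (redWord y).foldl (fun h s => mulGen s h) a

/-- The Kazhdan-Lusztig element
`C_w = ∑_{y ≤ w} (-1)^{ℓ(w)-ℓ(y)} q^{(ℓ(w)-ℓ(y))/2} P_{y,w}(q⁻¹) q^{-ℓ(y)/2} T_y`,
where all the polynomials `P_{y,w}` with `y ≤ w` are equal to `1` for the infinite dihedral
group. -/
def klC (w : AffineWeyl) : Hecke :=
  ∑ y ∈ lower w, Finsupp.single y ((-1) ^ (len w - len y) * qHalf ((len w : ℤ) - 2 * len y))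

/-- The involution `j(∑ a_w T_w) = ∑ \bar{a_w} (-1)^{ℓ(w)} q^{-ℓ(w)} T_w`, where the bar is
`q^{1/2} ↦ q^{-1/2}`. -/
def jInv (a : Hecke) : Hecke :=
  a.sum fun w c =>
    Finsupp.single w (LaurentPolynomial.invert c * ((-1) ^ len w * qHalf (-2 * len w)))

/-- The Kazhdan-Lusztig element `C'_w = (-1)^{ℓ(w)} j(C_w)`. -/
def klC' (w : AffineWeyl) : Hecke := ((-1) ^ len w : Coeff) • jInv (klC w)

theorem klC_apply (w z : AffineWeyl) :
    klC w z = if z ∈ lower w then (-1) ^ (len w - len z) * qHalf ((len w : ℤ) - 2 * len z)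
      else 0 := by
  classical
  simp [klC, Finsupp.finsetSum_apply, Finsupp.single_apply]

theorem klC_self (w : AffineWeyl) : klC w w = qHalf (-(len w : ℤ)) := by
  rw [klC_apply, if_pos (self_mem_lower w)]
  simp only [Nat.sub_self, pow_zero, one_mul]
  congr 1
  ring

theorem klC_apply_eq_zero {w z : AffineWeyl} (h : len w ≤ len z) (hne : z ≠ w) :
    klC w z = 0 := by
  rw [klC_apply, if_neg]
  intro hz
  exact absurd (len_lt_of_mem_lower hz hne) (by omega)

theorem linearIndependent_klC : LinearIndependent Coeff klC := by
  rw [linearIndependent_iff]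
  intro l hl
  by_contra hne
  obtain ⟨w, hw, hmax⟩ := l.support.exists_max_image len (Finsupp.support_nonempty_iff.2 hne)
  have h := DFunLike.congr_fun hl w
  rw [Finsupp.linearCombination_apply, Finsupp.sum, Finsupp.finsetSum_apply,
    Finset.sum_eq_single w] at h
  · rw [Finsupp.smul_apply, klC_self, smul_eq_mul, Finsupp.zero_apply] at h
    have h2 : l w * qHalf (-(len w : ℤ)) * qHalf (len w : ℤ) = 0 := by rw [h, zero_mul]
    rw [mul_assoc, ← LaurentPolynomial.T_add, neg_add_cancel, LaurentPolynomial.T_zero,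
      mul_one] at h2
    exact Finsupp.mem_support_iff.1 hw h2
  · intro x hx hxw
    rw [Finsupp.smul_apply, klC_apply_eq_zero (hmax x hx) hxw.symm, smul_zero]
  · intro h'
    exact absurd hw h'

theorem single_mem_span_klC (n : ℕ) : ∀ w : AffineWeyl, len w = n →
    (Finsupp.single w 1 : Hecke) ∈ Submodule.span Coeff (Set.range klC) := by
  induction n using Nat.strong_induction_on with
  | _ n ih =>
    intro w hw
    have h1 : klC w = Finsupp.single w (qHalf (-(len w : ℤ))) +
        ∑ y ∈ (lower w).erase w,
          Finsupp.single y ((-1) ^ (len w - len y) * qHalf ((len w : ℤ) - 2 * len y)) := by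
      rw [klC, ← Finset.add_sum_erase _ _ (self_mem_lower w)]
      simp only [Nat.sub_self, pow_zero, one_mul]
      congr 3
      ring
    have h2 : (Finsupp.single w 1 : Hecke) = qHalf (len w : ℤ) • (klC w -
        ∑ y ∈ (lower w).erase w,
          ((-1) ^ (len w - len y) * qHalf ((len w : ℤ) - 2 * len y)) •
            (Finsupp.single y 1 : Hecke)) := by
      rw [h1]
      simp only [Finsupp.smul_single, smul_eq_mul, mul_one, add_sub_cancel_right]
      rw [← LaurentPolynomial.T_add, add_neg_cancel, LaurentPolynomial.T_zero]
    rw [h2]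
    refine Submodule.smul_mem _ _ (Submodule.sub_mem _ (Submodule.subset_span ⟨w, rfl⟩)
      (Submodule.sum_mem _ fun y hy => Submodule.smul_mem _ _ ?_))
    rw [Finset.mem_erase] at hy
    exact ih (len y) (hw ▸ len_lt_of_mem_lower hy.2 hy.1) y rfl

theorem span_klC : ⊤ ≤ Submodule.span Coeff (Set.range klC) := by
  intro a _
  rw [← Finsupp.sum_single a]
  refine Submodule.sum_mem _ fun w _ => ?_
  have : (Finsupp.single w (a w) : Hecke) = a w • Finsupp.single w 1 := by simp
  rw [this]
  exact Submodule.smul_mem _ _ (single_mem_span_klC _ w rfl)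

/-- The Kazhdan-Lusztig basis `{C_w}` of `H`. -/
def klBasis : Module.Basis AffineWeyl Coeff Hecke :=
  Module.Basis.mk linearIndependent_klC span_klC

/-- The structure constants `h_{x,y,z}`, defined by `C_x C_y = ∑_z h_{x,y,z} C_z`. -/
def structConst (x y z : AffineWeyl) : Coeff := klBasis.repr (mul (klC x) (klC y)) z

/-! ### The asymptotic Hecke algebra and the map `φ ∘ j` on completions -/

/-- Lusztig's `a`-function: the least `n` such that `(-q^{1/2})^n h_{x,y,z} ∈ ℤ[q^{1/2}]` for all
`x, y`. -/
def aFun (z : AffineWeyl) : ℕ :=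
  sInf {n | ∀ x y, ∀ k < 0, ((-qHalf 1) ^ n * structConst x y z).coeff k = 0}

/-- The distinguished involutions. -/
def distInv : Finset AffineWeyl := {1, gen 0, gen 1}

/-- A Laurent polynomial regarded as a formal Laurent series in the same variable. -/
def toSeries (c : Coeff) : LaurentSeries ℤ := HahnSeries.ofFinsupp c.coeff

/-- Families `(b_x)` of Laurent series with `b_x → 0`: for every `N`, the series `b_x` is divisible
by the `N`-th power of the variable as soon as `ℓ(x)` is large. Such families are the elements
`∑ b_x C_x` of the completion of `H` (variable `q^{1/2}`), and also the elements `∑ b_x C'_x` of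
the completion with respect to negative powers (variable `q^{-1/2}`). -/
def TendsToZero (b : AffineWeyl → LaurentSeries ℤ) : Prop :=
  ∀ N : ℤ, ∃ L : ℕ, ∀ x, L ≤ len x → ∀ k < N, (b x).coeff k = 0

/-- `φ (∑ b_x C_x) = ∑ b_x h_{x,d,z} t_z`, the sum being over `x, z` and over the distinguished
involutions `d` with `a(d) = a(z)`; elements of the completion of `J` are families of
coefficients with respect to `{t_z}`. -/
def phi (b : AffineWeyl → LaurentSeries ℤ) (z : AffineWeyl) : LaurentSeries ℤ :=
  ∑ᶠ x, ∑ d ∈ distInv with aFun d = aFun z, b x * toSeries (structConst x d z)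

/-- The extension of `j` to completions, from families of coefficients with respect to `{C'_x}` to
families of coefficients with respect to `{C_x}`:
`j (∑ a_x C'_x) = ∑ \bar{a_x} (-1)^{ℓ(x)} C_x`. The bar turns a series in `q^{-1/2}` into the
series in `q^{1/2}` with the same coefficients. -/
def jHat (a : AffineWeyl → LaurentSeries ℤ) (x : AffineWeyl) : LaurentSeries ℤ :=
  (-1) ^ len x * a x

/-- `a` is the family of coefficients, with respect to `{C'_x}`, of an element of the completion of
`H` whose image under `φ ∘ j` is the basis element `t_y` of `J`. -/
def IsPreimageT (y : AffineWeyl) (a : AffineWeyl → LaurentSeries ℤ) : Prop :=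
  TendsToZero a ∧ phi (jHat a) = Pi.single y 1

/-- The coefficient of `q^{-k/2}` in the coefficient of `T_w` in `∑ a_x C'_x`. The coefficient of
`T_w` in `C'_x` is expanded in the variable `q^{-1/2}`, hence the inversion. -/
def tCoeff (a : AffineWeyl → LaurentSeries ℤ) (w : AffineWeyl) (k : ℤ) : ℤ :=
  ∑ᶠ x, (a x * toSeries (LaurentPolynomial.invert (klC' x w))).coeff k

/-! ### The group `SL₂(F)` -/

variable {F : Type*} [Field F] [ValuativeRel F]

/-- A uniformizer of `F`. -/
def IsUniformizer (ϖ : Fˣ) : Prop :=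
  ∃ h : (ϖ : F) ∈ 𝒪[F], Irreducible (⟨(ϖ : F), h⟩ : 𝒪[F])

/-- `diag(u, u⁻¹)`. -/
def torus (u : Fˣ) : SL(2, F) := ⟨!![(u : F), 0; 0, ((u⁻¹ : Fˣ) : F)], by simp [det_fin_two]⟩

/-- The standard representative of the nontrivial element of the finite Weyl group. -/
def weylElt : SL(2, F) := ⟨!![0, -1; 1, 0], by simp [det_fin_two]⟩

/-- A representative in `SL₂(F)` of an element of the affine Weyl group. -/
def lift (ϖ : Fˣ) : AffineWeyl → SL(2, F)
  | .r n => torus (ϖ ^ (show ℤ from n))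
  | .sr n => weylElt * torus (ϖ ^ (show ℤ from n))

variable (F) in
/-- The maximal compact subgroup `K = SL₂(𝒪)`. -/
def maxCompact : Subgroup SL(2, F) :=
  (SpecialLinearGroup.map (n := Fin 2) (algebraMap 𝒪[F] F)).range

variable (F) in
/-- The Iwahori subgroup: the matrices of `SL₂(𝒪)` that are upper triangular modulo the maximal
ideal. -/
def iwahori : Subgroup SL(2, F) :=
  Subgroup.map (SpecialLinearGroup.map (n := Fin 2) (algebraMap 𝒪[F] F))
    { carrier := {g | g 1 0 ∈ 𝓂[F]}
      one_mem' := by simp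
      mul_mem' := by
        intro g h hg hh
        have e : (g * h) 1 0 = g 1 0 * h 0 0 + g 1 1 * h 1 0 :=
          (Matrix.mul_apply (M := g.1) (N := h.1) (i := 1) (k := 0)).trans (Fin.sum_univ_two _)
        rw [Set.mem_ofPred_eq] at hg hh ⊢
        rw [e]
        exact Ideal.add_mem _ (Ideal.mul_mem_right _ _ hg) (Ideal.mul_mem_left _ _ hh)
      inv_mem' := by
        intro g hg
        rw [Set.mem_ofPred_eq] at hg ⊢
        rw [SpecialLinearGroup.SL2_inv_expl]
        simpa using hg }

/-- The double coset `I w I`, whose characteristic function is `T_w`. -/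
def iwahoriCell (ϖ : Fˣ) (w : AffineWeyl) : Set SL(2, F) :=
  DoubleCoset.doubleCoset (lift ϖ w) (iwahori F) (iwahori F)

variable [TopologicalSpace F] [IsNonarchimedeanLocalField F]

variable (F) in
/-- The cardinality `q` of the residue field. -/
def resCard : ℕ := Nat.card 𝓀[F]

open scoped Classical in
/-- The normalized absolute value of `F`. -/
def absF (x : F) : ℝ :=
  if x = 0 then 0
  else (resCard F : ℝ) ^
    (WithZero.log (IsNonarchimedeanLocalField.valueGroupWithZeroIsoInt F (valuation F x)))

/-- `λ(g)`: the natural number `n` with `g ∈ K diag(ϖ^n, ϖ^{-n}) K`. -/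
def cartan (ϖ : Fˣ) (g : SL(2, F)) : ℕ :=
  sInf {n | g ∈ DoubleCoset.doubleCoset (torus (ϖ ^ n)) (maxCompact F : Set SL(2, F))
    (maxCompact F)}

/-- `Δ(g) = q^{⟨λ(g), ρ⟩}`, where `⟨n α^∨, ρ⟩ = n`. -/
def cartanDelta (ϖ : Fˣ) (g : SL(2, F)) : ℝ := (resCard F : ℝ) ^ cartan ϖ g

/-- The value at `g` of the polynomial function on `SL₂` given by a polynomial in the matrix
entries. -/
def polyFun (p : MvPolynomial (Fin 2 × Fin 2) F) (g : SL(2, F)) : F :=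
  MvPolynomial.eval (fun ij => g ij.1 ij.2) p

/-- `f` lies in the Harish-Chandra Schwartz space of `SL₂(F)`. The inequality
`Δ(g) |f(g)| ≤ C / (log (1 + |p(g)|))^m` is written without denominators, so that it is no
condition where `p(g) = 0`. -/
def IsSchwartz (ϖ : Fˣ) (f : SL(2, F) → ℂ) : Prop :=
  (∃ U : Subgroup SL(2, F), IsOpen (U : Set SL(2, F)) ∧ IsCompact (U : Set SL(2, F)) ∧
    ∀ u ∈ U, ∀ v ∈ U, ∀ g, f (u * g * v) = f g) ∧
  ∀ (p : MvPolynomial (Fin 2 × Fin 2) F) (m : ℝ), 0 < m → ∃ C : ℝ, ∀ g : SL(2, F),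
    cartanDelta ϖ g * ‖f g‖ * Real.log (1 + absF (polyFun p g)) ^ m ≤ C

/-- `f` is the function on `SL₂(F)` represented by `∑ a_x C'_x`: on each `I w I` it is constant,
with value the coefficient of `T_w`, a series in `q^{-1/2}`, evaluated at the cardinality `q` of
the residue field. -/
def Represents (ϖ : Fˣ) (a : AffineWeyl → LaurentSeries ℤ) (f : SL(2, F) → ℂ) : Prop :=
  ∀ w, ∀ g ∈ iwahoriCell ϖ w,
    HasSum (fun k : ℤ => (tCoeff a w k : ℂ) * (((Real.sqrt (resCard F))⁻¹ : ℝ) : ℂ) ^ k) (f g)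

open scoped Classical in
/-- The explicit coefficient of `T_w` in `t_y`, for `y ≠ 1`; here `y_k` is the product of the first
`k` letters of the reduced word of `y`. -/
def explicitCoeff (q : ℝ) (y w : AffineWeyl) : ℝ :=
  -(Real.sqrt q) ^ (len y - 1) * ∑ k ∈ Finset.Icc 1 (len y), q ^ ((k : ℤ) - len y) *
    (if StartsWith w (wordProd ((redWord y).take k)) then
      (-1) ^ len w * q ^ (-(len w : ℤ) + 1) / (1 + q)
    else if k ≤ len w then (-1) ^ (len w + 1) * q ^ (-(len w : ℤ)) / (1 + q)
    else (-1) ^ k * q ^ (-(k : ℤ) + 1) / (1 + q))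

end AsymptoticHecke

end

noncomputable section

namespace AsymptoticHecke

/-! ### The alcove coordinate on the affine Weyl group -/

/-! Write v = q^{1/2}. The infinite dihedral group is the line ℤ via `pos`: length is |pos|, right
multiplication by a simple reflection moves to a neighbour, and y ≤ w means ℓ(y) < ℓ(w) or y = w
(`mem_lower_iff`). Hence C_x C_s is -(v + v⁻¹)C_x if xs < x, and otherwise C_{xs} plus, when ℓ(x) ≥
2, the C of the preceding element (`mulC_klC_of_lt`, `mulC_klC_of_gt`). For y ≠ 1 the product C_x
C_y is 1 or -(v + v⁻¹) times an integral combination without C_1 (`exists_mul_klC`), so the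
a-function is 0 at 1 and 1 elsewhere. In the coordinate `pos`, φ is therefore a second-order
difference operator: b_0 at the origin and b_{k+1} + b_{k-1} - (v + v⁻¹)b_k at k ≠ 0 (`phi_one`,
`phi_ofPos`).

Uniqueness: along each ray the homogeneous recursion has characteristic roots v and v⁻¹, and a
solution that vanishes at the origin and tends to zero v-adically is zero (`eq_zero_of_recursion`).
Existence: v^{ℓ(x)+c}, cut off below length k on one ray, solves the recursion except at k - 1 and k
(`phiJ_rayFamily`). Suitable shifts c make these defects telescope to a single 1 at y
(`phiJ_preimageT`).

Coefficients: C'_x = v^{-ℓ(x)} ∑_{w ≤ x} T_w (`klC'_apply`), so the coefficient of T_w in a ray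
family is a geometric series of ratio -q⁻¹ which starts at the least admissible length (`threshold`,
`hasValue_rayFamily`). The possible starting points are the three cases of c_k(w). In particular the
coefficients are O(q^{-ℓ(w)}).

Schwartz condition: SL₂(F) is the disjoint union of the cells IwI (`exists_mem_iwahoriCell`,
`eq_of_mem_iwahoriCell`), which gives existence and uniqueness of the function. On IwI one has Δ ≤
q^n with 2n ≤ ℓ(w) + 1, so Δ|f| = O(q^{-n}), while log(1 + |p|) grows at most linearly in n for
every polynomial p. -/

/-- The signed position of `w` along its infinite reduced ray: reduced words starting with `s₀` are
counted positively, those starting with `s₁` negatively. -/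
def pos : AffineWeyl → ℤ
  | .r n => 2 * (show ℤ from n)
  | .sr n => 1 - 2 * (show ℤ from n)

theorem pos_r (n : ℤ) : pos (.r n) = 2 * n := rfl

theorem pos_sr (n : ℤ) : pos (.sr n) = 1 - 2 * n := rfl

theorem r_or_sr (w : AffineWeyl) : (∃ n : ℤ, w = .r n) ∨ ∃ n : ℤ, w = .sr n := by
  rcases w with n | n
  · exact Or.inl ⟨n, rfl⟩
  · exact Or.inr ⟨n, rfl⟩

/-- The element of the affine Weyl group in a given position. -/
def ofPos (k : ℤ) : AffineWeyl :=
  if k % 2 = 0 then .r (show ℤ from k / 2) else .sr (show ℤ from (1 - k) / 2)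

@[simp] theorem pos_ofPos (k : ℤ) : pos (ofPos k) = k := by
  unfold ofPos
  split_ifs with h
  · rw [pos_r]
    change 2 * (k / 2) = k
    omega
  · rw [pos_sr]
    change 1 - 2 * ((1 - k) / 2) = k
    omega

@[simp] theorem ofPos_pos (w : AffineWeyl) : ofPos (pos w) = w := by
  obtain ⟨n, rfl⟩ | ⟨n, rfl⟩ := r_or_sr w
  · rw [pos_r, ofPos, if_pos (by omega)]
    exact congrArg (fun m : ℤ => (DihedralGroup.r m : AffineWeyl)) (show 2 * n / 2 = n by omega)
  · rw [pos_sr, ofPos, if_neg (by omega)]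
    exact congrArg (fun m : ℤ => (DihedralGroup.sr m : AffineWeyl))
      (show (1 - (1 - 2 * n)) / 2 = n by omega)

/-- The bijection between the affine Weyl group and `ℤ` given by positions. -/
def posEquiv : AffineWeyl ≃ ℤ := ⟨pos, ofPos, ofPos_pos, pos_ofPos⟩

theorem pos_injective : Function.Injective pos := posEquiv.injective

theorem pos_mul (x y : AffineWeyl) :
    pos (x * y) = if pos x % 2 = 0 then pos x + pos y else pos x - pos y := by
  obtain ⟨a, rfl⟩ | ⟨a, rfl⟩ := r_or_sr x <;> obtain ⟨b, rfl⟩ | ⟨b, rfl⟩ := r_or_sr y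
  · rw [pos_r, pos_r, if_pos (by omega)]
    change 2 * (a + b) = _
    ring
  · rw [pos_r, pos_sr, if_pos (by omega)]
    change 1 - 2 * (b - a) = _
    ring
  · rw [pos_r, pos_sr, if_neg (by omega)]
    change 1 - 2 * (a + b) = _
    ring
  · rw [pos_sr, pos_sr, if_neg (by omega)]
    change 2 * (b - a) = _
    ring

@[simp] theorem pos_one : pos 1 = 0 := rfl

@[simp] theorem pos_gen_zero : pos (gen 0) = 1 := rfl

@[simp] theorem pos_gen_one : pos (gen 1) = -1 := rfl

theorem pos_eq_zero {w : AffineWeyl} : pos w = 0 ↔ w = 1 :=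
  ⟨fun h => pos_injective h, fun h => h ▸ rfl⟩

theorem pos_inv (x : AffineWeyl) : pos x⁻¹ = if pos x % 2 = 0 then -pos x else pos x := by
  have h := pos_mul x x⁻¹
  rw [mul_inv_cancel, pos_one] at h
  split_ifs at h ⊢ <;> omega

/-- Left multiplication acts on positions by isometries of ℤ: translations for even positions,
reflections for odd ones. -/
theorem natAbs_pos_inv_mul (x y : AffineWeyl) :
    (pos (x⁻¹ * y)).natAbs = (pos y - pos x).natAbs := by
  have h1 := pos_mul x⁻¹ y
  have h2 := pos_inv x
  split_ifs at h1 h2 <;> omega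

/-- The edge from k to k + 1 carries the label s₀ for even k and s₁ for odd k. -/
theorem pos_mul_gen (w : AffineWeyl) (s : Fin 2) :
    pos (w * gen s) = if (pos w + s) % 2 = 0 then pos w + 1 else pos w - 1 := by
  rw [pos_mul]
  fin_cases s
  · simp
  · have : pos (gen (1 : Fin 2)) = -1 := rfl
    simp only [Fin.mk_one, this, Nat.cast_one]
    split_ifs <;> omega

theorem gen_mul_gen (s : Fin 2) : gen s * gen s = 1 := by
  apply pos_injective
  rw [pos_mul_gen]
  fin_cases s <;> decide

theorem mul_gen_mul_gen (w : AffineWeyl) (s : Fin 2) : w * gen s * gen s = w := by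
  rw [mul_assoc, gen_mul_gen, mul_one]

theorem natAbs_pos_mul_wordProd (w : AffineWeyl) (ω : List (Fin 2)) :
    (pos (w * wordProd ω) - pos w).natAbs ≤ ω.length := by
  induction ω generalizing w with
  | nil => simp [wordProd]
  | cons s ω ih =>
    have h1 := ih (w * gen s)
    have h2 := pos_mul_gen w s
    have h3 : wordProd (s :: ω) = gen s * wordProd ω := by simp [wordProd]
    rw [h3, ← mul_assoc, List.length_cons]
    split_ifs at h2 <;> omega

theorem exists_gen_descent {w : AffineWeyl} (h : w ≠ 1) :
    ∃ s : Fin 2, (pos (w * gen s)).natAbs + 1 = (pos w).natAbs := by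
  have h0 : pos w ≠ 0 := mt pos_eq_zero.1 h
  by_cases h1 : (0 < pos w ∧ pos w % 2 = 1) ∨ (pos w < 0 ∧ pos w % 2 = 0)
  · refine ⟨0, ?_⟩
    rw [pos_mul_gen]
    simp only [Fin.val_zero, Nat.cast_zero]
    split_ifs <;> omega
  · refine ⟨1, ?_⟩
    rw [pos_mul_gen]
    simp only [Fin.val_one, Nat.cast_one]
    split_ifs <;> omega

theorem exists_word_natAbs_pos (n : ℕ) :
    ∀ w, (pos w).natAbs = n → ∃ ω, ω.length = n ∧ wordProd ω = w := by
  induction n with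
  | zero =>
    intro w hw
    exact ⟨[], rfl, (pos_eq_zero.1 (by omega)).symm⟩
  | succ n ih =>
    intro w hw
    obtain ⟨s, hs⟩ := exists_gen_descent (w := w) (fun h => by simp [h] at hw)
    obtain ⟨ω, hω, hω'⟩ := ih (w * gen s) (by omega)
    refine ⟨ω ++ [s], by simp [hω], ?_⟩
    rw [wordProd_append, hω']
    simp [wordProd, mul_gen_mul_gen]

theorem len_eq (w : AffineWeyl) : len w = (pos w).natAbs := by
  apply le_antisymm
  · obtain ⟨ω, hω, hω'⟩ := exists_word_natAbs_pos _ w rfl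
    rw [← hω]
    conv_lhs => rw [← hω']
    exact len_wordProd_le ω
  · obtain ⟨ω, hω, hω'⟩ := exists_reduced w
    have := natAbs_pos_mul_wordProd 1 ω
    rw [one_mul, hω'] at this
    simpa [hω] using this

theorem len_ofPos (k : ℤ) : len (ofPos k) = k.natAbs := by rw [len_eq, pos_ofPos]

theorem len_one : len 1 = 0 := by simp [len_eq]

theorem len_gen (s : Fin 2) : len (gen s) = 1 := by
  rw [len_eq]; fin_cases s <;> rfl

theorem gen_ne_one (s : Fin 2) : gen s ≠ 1 := by
  intro h
  have := len_gen s
  rw [h, len_one] at this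
  omega

theorem len_eq_zero {w : AffineWeyl} : len w = 0 ↔ w = 1 := by
  rw [len_eq, Int.natAbs_eq_zero, pos_eq_zero]

theorem startsWith_iff (w y : AffineWeyl) :
    StartsWith w y ↔ (0 ≤ pos y ∧ pos y ≤ pos w) ∨ (pos y ≤ 0 ∧ pos w ≤ pos y) := by
  unfold StartsWith
  rw [len_eq, len_eq, len_eq, natAbs_pos_inv_mul]
  omega

theorem len_mul_gen (w : AffineWeyl) (s : Fin 2) :
    len (w * gen s) = len w + 1 ∨ len (w * gen s) + 1 = len w := by
  rw [len_eq, len_eq, pos_mul_gen]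
  split_ifs <;> omega

/-- Two elements of the same length with a common right descent agree. -/
theorem eq_of_len_eq {x z : AffineWeyl} {s : Fin 2} (hx : len (x * gen s) < len x)
    (hz : len (z * gen s) < len z) (h : len x = len z) : x = z := by
  apply pos_injective
  rw [len_eq, len_eq, pos_mul_gen] at hx hz
  rw [len_eq, len_eq] at h
  split_ifs at hx hz <;> omega

theorem exists_len_mul_gen_lt {w : AffineWeyl} (h : w ≠ 1) :
    ∃ s : Fin 2, len (w * gen s) < len w := by
  obtain ⟨s, hs⟩ := exists_gen_descent h
  exact ⟨s, by rw [len_eq, len_eq]; omega⟩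

/-- The right descent of an element is unique. -/
theorem descent_unique {w : AffineWeyl} {s t : Fin 2} (hs : len (w * gen s) < len w)
    (ht : len (w * gen t) < len w) : s = t := by
  rw [len_eq, len_eq, pos_mul_gen] at hs ht
  split_ifs at hs ht <;> omega

theorem len_one_mul_gen (s : Fin 2) : ¬ len (1 * gen s) < len 1 := by
  rw [one_mul, len_gen, len_one]; omega

/-! ### Reduced words -/

theorem wordProd_singleton (s : Fin 2) : wordProd [s] = gen s := by simp [wordProd]

/-- A nontrivial element has only one right descent, which forces the last letter. This makes the
word chosen in `redWord` accessible letter by letter. -/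
theorem reduced_unique (ω ω' : List (Fin 2)) (h : wordProd ω = wordProd ω')
    (hω : ω.length = len (wordProd ω)) (hω' : ω'.length = len (wordProd ω')) : ω = ω' := by
  induction ω using List.reverseRecOn generalizing ω' with
  | nil =>
    have : ω'.length = 0 := by rw [hω', ← h, ← hω]; rfl
    exact (List.length_eq_zero_iff.1 this).symm
  | append_singleton ω s ih =>
    induction ω' using List.reverseRecOn with
    | nil =>
      have : (ω ++ [s]).length = 0 := by rw [hω, h, ← hω']; rfl
      simp at this
    | append_singleton ω' s' _ =>
      have key : ∀ (τ : List (Fin 2)) (t : Fin 2), (τ ++ [t]).length = len (wordProd (τ ++ [t])) →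
          wordProd τ = wordProd (τ ++ [t]) * gen t ∧ τ.length = len (wordProd τ) ∧
          len (wordProd (τ ++ [t]) * gen t) < len (wordProd (τ ++ [t])) := by
        intro τ t h
        have h1 : wordProd τ = wordProd (τ ++ [t]) * gen t := by
          rw [wordProd_append, wordProd_singleton, mul_gen_mul_gen]
        have h2 := len_wordProd_le τ
        have h3 := len_mul_gen (wordProd (τ ++ [t])) t
        rw [← h1] at h3 ⊢
        rw [List.length_append, List.length_singleton] at h
        exact ⟨rfl, by omega, by omega⟩
      obtain ⟨h1, h2, h3⟩ := key ω s hω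
      obtain ⟨h1', h2', h3'⟩ := key ω' s' hω'
      rw [← h] at h3'
      obtain rfl := descent_unique h3 h3'
      rw [ih ω' (by rw [h1, h1', h]) h2 h2']

theorem redWord_mul_gen {w : AffineWeyl} {s : Fin 2} (h : len w < len (w * gen s)) :
    redWord (w * gen s) = redWord w ++ [s] := by
  have h1 : wordProd (redWord w ++ [s]) = w * gen s := by
    rw [wordProd_append, wordProd_singleton, wordProd_redWord]
  have h2 := len_mul_gen w s
  apply reduced_unique
  · rw [wordProd_redWord, h1]
  · rw [wordProd_redWord, redWord_length]
  · rw [h1, List.length_append, redWord_length, List.length_singleton]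
    omega

theorem redWord_one : redWord 1 = [] := by
  rw [← List.length_eq_zero_iff, redWord_length, len_one]

theorem redWord_gen (s : Fin 2) : redWord (gen s) = [s] := by
  have := redWord_mul_gen (w := 1) (s := s) (by rw [one_mul, len_gen, len_one]; omega)
  rwa [one_mul, redWord_one, List.nil_append] at this

/-- The product of the first `k` letters of the reduced word of `y`. -/
theorem pos_wordProd_take (y : AffineWeyl) {k : ℕ} (hk : k ≤ len y) :
    pos (wordProd ((redWord y).take k)) = (pos y).sign * k := by
  -- The prefix lies within k of the origin and within ℓ(y) - k of y, so it is the point at distance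
  -- k on the segment joining them.
  have h1 := natAbs_pos_mul_wordProd 1 ((redWord y).take k)
  have h2 := natAbs_pos_mul_wordProd (wordProd ((redWord y).take k)) ((redWord y).drop k)
  rw [← wordProd_append, List.take_append_drop, wordProd_redWord, List.length_drop,
    redWord_length] at h2
  rw [one_mul, List.length_take, redWord_length, pos_one] at h1
  rw [len_eq] at *
  rcases lt_trichotomy (pos y) 0 with h | h | h
  · rw [Int.sign_eq_neg_one_of_neg h]; omega
  · rw [h] at hk ⊢
    simp at hk
    simp only [hk, Int.sign_zero] at *
    omega
  · rw [Int.sign_eq_one_of_pos h]; omega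

theorem mem_lower_iff {w y : AffineWeyl} : y ∈ lower w ↔ len y < len w ∨ y = w := by
  constructor
  · intro h
    by_cases hne : y = w
    · exact Or.inr hne
    · exact Or.inl (len_lt_of_mem_lower h hne)
  · rintro (h | rfl)
    swap
    · exact self_mem_lower y
    -- On the ray of w, a prefix of the reduced word gives y. On the opposite ray, the first letter
    -- is dropped before a prefix is taken.
    by_cases hs : 0 ≤ pos y * pos w
    · refine mem_lower.2 ⟨_, List.take_sublist (len y) _, pos_injective ?_⟩
      rw [pos_wordProd_take _ h.le]
      rw [len_eq, len_eq] at *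
      rcases lt_trichotomy (pos w) 0 with h' | h' | h'
      · rw [Int.sign_eq_neg_one_of_neg h']
        have := nonpos_of_mul_nonneg_left hs h'
        omega
      · omega
      · rw [Int.sign_eq_one_of_pos h']
        have := nonneg_of_mul_nonneg_left hs h'
        omega
    · obtain ⟨s, ω, hω⟩ : ∃ s ω, redWord w = s :: ω := by
        cases hω : redWord w with
        | nil =>
          have := redWord_length w
          rw [hω, List.length_nil] at this
          omega
        | cons s ω => exact ⟨s, ω, rfl⟩
      refine mem_lower.2 ⟨ω.take (len y), ?_, pos_injective ?_⟩
      · rw [hω]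
        exact (List.take_sublist _ _).trans (List.sublist_cons_self _ _)
      have h1 := pos_wordProd_take w (k := 1) (by omega)
      have h2 := pos_wordProd_take w (k := len y + 1) (by omega)
      rw [hω, List.take_succ_cons, List.take_zero, wordProd_singleton] at h1
      rw [hω, List.take_succ_cons, ← List.singleton_append, wordProd_append, wordProd_singleton,
        pos_mul, h1] at h2
      rw [len_eq, len_eq] at *
      rcases lt_trichotomy (pos w) 0 with h' | h' | h'
      · rw [Int.sign_eq_neg_one_of_neg h'] at h2
        have : 0 < pos y := by
          by_contra hc
          exact hs (mul_nonneg_of_nonpos_of_nonpos (by omega) (by omega))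
        rw [if_neg (by omega)] at h2
        omega
      · omega
      · rw [Int.sign_eq_one_of_pos h'] at h2
        have : pos y < 0 := by
          by_contra hc
          exact hs (mul_nonneg (by omega) (by omega))
        rw [if_neg (by omega)] at h2
        omega

/-! ### Products in the Hecke algebra -/

theorem mulGen_single (s : Fin 2) (w : AffineWeyl) (c : Coeff) :
    mulGen s (Finsupp.single w c) = c • (if len w < len (w * gen s) then
      Finsupp.single (w * gen s) 1
    else Finsupp.single w (qHalf 2 - 1) + Finsupp.single (w * gen s) (qHalf 2)) := by
  rw [mulGen, Finsupp.linearCombination_single]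

/-- The transposed form of the definition: only the pair {z, zs} matters, so identities can be
checked pair by pair. -/
theorem mulGen_apply (s : Fin 2) (a : Hecke) (z : AffineWeyl) :
    mulGen s a z = if len (z * gen s) < len z then a (z * gen s) + (qHalf 2 - 1) * a z
      else qHalf 2 * a (z * gen s) := by
  classical
  induction a using Finsupp.induction_linear with
  | zero => simp
  | add f g hf hg =>
    rw [map_add, Finsupp.add_apply, hf, hg]
    split_ifs <;> simp only [Finsupp.add_apply] <;> ring
  | single w c =>
    rw [mulGen_single]
    have h1 := len_mul_gen z s
    have h2 := len_mul_gen w s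
    by_cases hw : w = z
    · subst hw
      have hne : w * gen s ≠ w := fun h => by rw [h] at h1; omega
      split_ifs with h3 h4 h4
      · omega
      · simp [hne, hne.symm]
      · simp [hne, hne.symm, mul_comm]
      · omega
    · by_cases hw' : w * gen s = z
      · subst hw'
        rw [mul_gen_mul_gen] at *
        split_ifs with h3 <;> simp [hw, mul_comm]
      · have : w ≠ z * gen s := fun h => hw' (by rw [h, mul_gen_mul_gen])
        split_ifs <;> simp [hw, hw', this]

theorem mulGen_mulGen (s : Fin 2) (a : Hecke) :
    mulGen s (mulGen s a) = (qHalf 2 - 1) • mulGen s a + qHalf 2 • a := by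
  ext1 z
  have h1 := len_mul_gen z s
  rw [Finsupp.add_apply, Finsupp.smul_apply, Finsupp.smul_apply]
  simp only [mulGen_apply, mul_gen_mul_gen, smul_eq_mul]
  split_ifs <;> first | omega | ring

/-- Left multiplication by `a`, as a linear map. -/
def mulLeft (a : Hecke) : Hecke →ₗ[Coeff] Hecke :=
  Finsupp.linearCombination Coeff fun y => (redWord y).foldl (fun h s => mulGen s h) a

theorem mul_eq_mulLeft (a b : Hecke) : mul a b = mulLeft a b := rfl

theorem mul_single (a : Hecke) (y : AffineWeyl) (c : Coeff) :
    mulLeft a (Finsupp.single y c) = c • (redWord y).foldl (fun h s => mulGen s h) a := by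
  rw [mulLeft, Finsupp.linearCombination_single]

/-- This instance (aT_s-module structure) a(bT_s) = (ab)T_s is all the associativity that is needed.
It holds by definition of the product when s lengthens w, and by the quadratic relation
`mulGen_mulGen` otherwise. -/
theorem mul_mulGen (s : Fin 2) (a b : Hecke) :
    mulLeft a (mulGen s b) = mulGen s (mulLeft a b) := by
  induction b using Finsupp.induction_linear with
  | zero => simp
  | add f g hf hg => simp only [map_add, hf, hg]
  | single w c =>
    rw [mulGen_single, map_smul, mul_single, map_smul]
    congr 1
    have h1 := len_mul_gen w s
    split_ifs with h
    · rw [mul_single, redWord_mul_gen h, List.foldl_append, one_smul]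
      rfl
    · have h2 : redWord w = redWord (w * gen s) ++ [s] := by
        rw [← redWord_mul_gen (by rw [mul_gen_mul_gen]; omega), mul_gen_mul_gen]
      rw [map_add, mul_single, mul_single]
      rw [h2, List.foldl_append]
      simp only [List.foldl_cons, List.foldl_nil]
      rw [mulGen_mulGen]

/-! ### Products of Kazhdan-Lusztig elements with C_s -/

/-- Right multiplication by `C_s` for a simple reflection `s`. -/
def mulC (s : Fin 2) : Hecke →ₗ[Coeff] Hecke := qHalf (-1) • mulGen s - qHalf 1 • LinearMap.id

theorem klC_one : klC 1 = Finsupp.single 1 1 := by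
  ext1 z
  rw [klC_apply, Finsupp.single_apply]
  by_cases h : z = 1
  · subst h
    rw [if_pos (self_mem_lower _), if_pos rfl, len_one]
    simp [qHalf]
  · rw [if_neg (Ne.symm h), if_neg]
    rw [mem_lower_iff, len_one]
    simpa using h

theorem klC_gen (s : Fin 2) :
    klC (gen s) = Finsupp.single (gen s) (qHalf (-1)) - Finsupp.single 1 (qHalf 1) := by
  ext1 z
  rw [klC_apply, Finsupp.sub_apply, Finsupp.single_apply, Finsupp.single_apply]
  simp only [mem_lower_iff, len_gen]
  by_cases h : z = 1
  · subst h
    rw [len_one]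
    simp [gen_ne_one, qHalf]
  · by_cases h' : z = gen s
    · subst h'
      rw [len_gen]
      simp [(gen_ne_one s).symm, qHalf]
    · have : len z ≠ 0 := mt len_eq_zero.1 h
      rw [if_neg, if_neg (Ne.symm h'), if_neg (Ne.symm h), sub_zero]
      rintro (h3 | h3)
      · omega
      · exact h' h3

theorem mul_klC_one (a : Hecke) : mulLeft a (klC 1) = a := by
  rw [klC_one, mul_single, redWord_one, List.foldl_nil, one_smul]

theorem mul_klC_gen (a : Hecke) (s : Fin 2) : mulLeft a (klC (gen s)) = mulC s a := by
  rw [klC_gen, map_sub, mul_single, mul_single, redWord_one, redWord_gen]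
  rfl

theorem mul_mulC (s : Fin 2) (a b : Hecke) :
    mulLeft a (mulC s b) = mulC s (mulLeft a b) := by
  simp only [mulC, LinearMap.sub_apply, LinearMap.smul_apply, map_sub, map_smul, mul_mulGen,
    LinearMap.id_apply]

theorem mulC_apply (s : Fin 2) (a : Hecke) (z : AffineWeyl) :
    mulC s a z = if len (z * gen s) < len z then qHalf (-1) * (a (z * gen s) - a z)
      else qHalf 1 * (a (z * gen s) - a z) := by
  have h1 : qHalf (-1) * qHalf 2 = qHalf 1 := by rw [← LaurentPolynomial.T_add]; rfl
  have : mulC s a z = qHalf (-1) * mulGen s a z - qHalf 1 * a z := rfl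
  rw [this, mulGen_apply, ← h1]
  split_ifs <;> ring

/-- Elements of H C_s have coefficients in ratio -q at zs < z, and `klC_apply_mul_gen` gives the
same for C_w with ws < w. Identities between such elements need checking only at those z with zs <
z. -/
theorem mulC_apply_mul_gen {s : Fin 2} (a : Hecke) {z : AffineWeyl}
    (h : len (z * gen s) < len z) : mulC s a (z * gen s) = -qHalf 2 * mulC s a z := by
  have h1 : qHalf 1 = qHalf 2 * qHalf (-1) := by rw [← LaurentPolynomial.T_add]; rfl
  rw [mulC_apply, mulC_apply, mul_gen_mul_gen, if_pos h, if_neg (by omega), h1]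
  ring

theorem klC_apply_of_le {w z : AffineWeyl} (h : z ∈ lower w) :
    klC w z = (-1) ^ (len w + len z) * qHalf ((len w : ℤ) - 2 * len z) := by
  rw [klC_apply, if_pos h]
  congr 1
  rw [mem_lower_iff] at h
  have : len z ≤ len w := by
    rcases h with h | rfl
    · exact h.le
    · exact le_rfl
  obtain ⟨d, hd⟩ := Nat.exists_eq_add_of_le this
  rw [hd, show len z + d - len z = d by omega, show len z + d + len z = d + 2 * len z by ring,
    pow_add, pow_mul]
  simp

theorem klC_apply_mul_gen {s : Fin 2} {w z : AffineWeyl} (hw : len (w * gen s) < len w)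
    (hz : len (z * gen s) < len z) : klC w (z * gen s) = -qHalf 2 * klC w z := by
  have h1 := len_mul_gen z s
  have h2 := len_mul_gen w s
  have h3 : z * gen s ∈ lower w ↔ z ∈ lower w := by
    rw [mem_lower_iff, mem_lower_iff]
    constructor
    · rintro (h | h)
      · by_cases h' : len z = len w
        · exact Or.inr (eq_of_len_eq hz hw h')
        · exact Or.inl (by omega)
      · rw [← h, mul_gen_mul_gen] at hw
        omega
    · rintro (h | rfl)
      · exact Or.inl (by omega)
      · exact Or.inl hz
  by_cases h : z ∈ lower w
  · rw [klC_apply_of_le h, klC_apply_of_le (h3.2 h),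
      show len w + len z = len w + len (z * gen s) + 1 by omega,
      show (len w : ℤ) - 2 * len (z * gen s) = 2 + (len w - 2 * len z) by omega, qHalf,
      LaurentPolynomial.T_add, pow_succ]
    ring
  · rw [klC_apply, klC_apply, if_neg h, if_neg (mt h3.1 h), mul_zero]

theorem mulC_klC_of_lt {s : Fin 2} {w : AffineWeyl} (hw : len (w * gen s) < len w) :
    mulC s (klC w) = -(qHalf 1 + qHalf (-1)) • klC w := by
  have h1 : qHalf (-1) * qHalf 2 = qHalf 1 := by rw [← LaurentPolynomial.T_add]; rfl
  have key : ∀ z, len (z * gen s) < len z →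
      mulC s (klC w) z = -(qHalf 1 + qHalf (-1)) * klC w z := by
    intro z hz
    rw [mulC_apply, if_pos hz, klC_apply_mul_gen hw hz, ← h1]
    ring
  ext1 z
  rw [Finsupp.smul_apply, smul_eq_mul]
  have h2 := len_mul_gen z s
  by_cases hz : len (z * gen s) < len z
  · exact key z hz
  · have hz' : len (z * gen s * gen s) < len (z * gen s) := by rw [mul_gen_mul_gen]; omega
    have h3 := mulC_apply_mul_gen (klC w) hz'
    have h4 := klC_apply_mul_gen hw hz'
    rw [mul_gen_mul_gen] at h3 h4
    rw [h3, h4, key _ hz']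
    ring

/-- The element preceding `w` along its ray. -/
def prev (w : AffineWeyl) : AffineWeyl := ofPos (pos w - (pos w).sign)

theorem len_prev (w : AffineWeyl) : len (prev w) = len w - 1 := by
  rw [len_eq, len_eq, prev, pos_ofPos]
  rcases lt_trichotomy (pos w) 0 with h | h | h
  · rw [Int.sign_eq_neg_one_of_neg h]; omega
  · simp [h]
  · rw [Int.sign_eq_one_of_pos h]; omega

theorem prev_descent {w : AffineWeyl} {s : Fin 2} (h : len w < len (w * gen s))
    (hw : 2 ≤ len w) : len (prev w * gen s) < len (prev w) := by
  rw [len_eq, len_eq, pos_mul_gen] at *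
  rw [prev, pos_ofPos]
  rcases lt_trichotomy (pos w) 0 with h' | h' | h'
  · rw [Int.sign_eq_neg_one_of_neg h']; split_ifs at * <;> omega
  · simp [h'] at hw
  · rw [Int.sign_eq_one_of_pos h']; split_ifs at * <;> omega

/-- At z with zs < z the left side is v⁻¹(C_w(zs) - C_w(z)); the first term is the coefficient of
C_{ws} and the second that of the preceding element. For ℓ(w) ≤ 1 no such z lies below w, so the
second term vanishes. -/
theorem mulC_klC_of_gt {s : Fin 2} {w : AffineWeyl} (hw : len w < len (w * gen s)) :
    mulC s (klC w) = klC (w * gen s) + if 2 ≤ len w then klC (prev w) else 0 := by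
  have h0 := len_mul_gen w s
  have hws : len (w * gen s * gen s) < len (w * gen s) := by rwa [mul_gen_mul_gen]
  have hp := len_prev w
  have key : ∀ z, len (z * gen s) < len z →
      mulC s (klC w) z = klC (w * gen s) z + (if 2 ≤ len w then klC (prev w) else 0) z := by
    intro z hz
    have h1 := len_mul_gen z s
    rw [mulC_apply, if_pos hz]
    have e1 : z * gen s ∈ lower w ↔ len z ≤ len w + 1 := by
      rw [mem_lower_iff]
      constructor
      · rintro (h | h)
        · omega
        · rw [← h]; omega
      · intro h
        by_cases h' : len z = len w + 1
        · right
          rw [eq_of_len_eq hz hws (by omega), mul_gen_mul_gen]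
        · left; omega
    have e2 : z ∈ lower w ↔ len z < len w := by
      rw [mem_lower_iff]
      refine ⟨?_, Or.inl⟩
      rintro (h | rfl)
      · exact h
      · omega
    have e3 : z ∈ lower (w * gen s) ↔ len z ≤ len w + 1 := by
      rw [mem_lower_iff]
      constructor
      · rintro (h | rfl) <;> omega
      · intro h
        by_cases h' : len z = len w + 1
        · exact Or.inr (eq_of_len_eq hz hws (by omega))
        · left; omega
    have f1 : klC (w * gen s) z = qHalf (-1) * klC w (z * gen s) := by
      by_cases h : len z ≤ len w + 1
      · rw [klC_apply_of_le (e3.2 h), klC_apply_of_le (e1.2 h),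
          show len (w * gen s) + len z = len w + len (z * gen s) + 2 by omega,
          show (len (w * gen s) : ℤ) - 2 * len z = -1 + (len w - 2 * len (z * gen s)) by omega,
          qHalf, LaurentPolynomial.T_add, pow_add]
        ring
      · rw [klC_apply, klC_apply, if_neg (mt e3.1 h), if_neg (mt e1.1 h), mul_zero]
    have f2 : (if 2 ≤ len w then klC (prev w) else 0) z = -(qHalf (-1) * klC w z) := by
      by_cases h2 : 2 ≤ len w
      · rw [if_pos h2]
        have e4 : z ∈ lower (prev w) ↔ len z < len w := by
          rw [mem_lower_iff]
          constructor
          · rintro (h | rfl) <;> omega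
          · intro h
            by_cases h' : len z = len w - 1
            · exact Or.inr (eq_of_len_eq hz (prev_descent hw h2) (by omega))
            · left; omega
        by_cases h : len z < len w
        · rw [klC_apply_of_le (e4.2 h), klC_apply_of_le (e2.2 h),
            show len w + len z = len (prev w) + len z + 1 by omega,
            show (len (prev w) : ℤ) - 2 * len z = -1 + (len w - 2 * len z) by omega,
            qHalf, LaurentPolynomial.T_add, pow_succ]
          ring
        · rw [klC_apply, klC_apply, if_neg (mt e4.1 h), if_neg (mt e2.1 h), mul_zero, neg_zero]
      · rw [if_neg h2, klC_apply, if_neg (by rw [e2]; omega), mul_zero, neg_zero]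
        rfl
    rw [f1, f2]
    ring
  ext1 z
  have h2 := len_mul_gen z s
  by_cases hz : len (z * gen s) < len z
  · exact key z hz
  · have hz' : len (z * gen s * gen s) < len (z * gen s) := by rw [mul_gen_mul_gen]; omega
    have h3 := mulC_apply_mul_gen (klC w) hz'
    have h4 := klC_apply_mul_gen hws hz'
    have h5 : (if 2 ≤ len w then klC (prev w) else 0) (z * gen s * gen s) =
        -qHalf 2 * (if 2 ≤ len w then klC (prev w) else 0) (z * gen s) := by
      split_ifs with h
      · exact klC_apply_mul_gen (prev_descent hw h) hz'
      · simp
    rw [mul_gen_mul_gen] at h3 h4 h5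
    rw [Finsupp.add_apply, h3, h4, h5, key _ hz']
    ring

/-! ### Structure constants and the `a`-function -/

theorem klBasis_apply (w : AffineWeyl) : klBasis w = klC w := by
  rw [klBasis, Module.Basis.mk_apply]

theorem repr_klC (w : AffineWeyl) : klBasis.repr (klC w) = Finsupp.single w 1 := by
  rw [← klBasis_apply, Module.Basis.repr_self]

theorem structConst_one (x z : AffineWeyl) : structConst x 1 z = if x = z then 1 else 0 := by
  classical
  rw [structConst, mul_eq_mulLeft, mul_klC_one, repr_klC, Finsupp.single_apply]

theorem structConst_gen_of_lt {x : AffineWeyl} {s : Fin 2} (h : len (x * gen s) < len x)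
    (z : AffineWeyl) :
    structConst x (gen s) z = if x = z then -(qHalf 1 + qHalf (-1)) else 0 := by
  classical
  rw [structConst, mul_eq_mulLeft, mul_klC_gen, mulC_klC_of_lt h, map_smul, repr_klC,
    Finsupp.smul_apply, Finsupp.single_apply]
  split_ifs <;> simp

theorem structConst_gen_of_gt {x : AffineWeyl} {s : Fin 2} (h : len x < len (x * gen s))
    (z : AffineWeyl) :
    structConst x (gen s) z = (if x * gen s = z then 1 else 0) +
      if 2 ≤ len x ∧ prev x = z then 1 else 0 := by
  classical
  rw [structConst, mul_eq_mulLeft, mul_klC_gen, mulC_klC_of_gt h, map_add, repr_klC,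
    Finsupp.add_apply, Finsupp.single_apply]
  by_cases h2 : 2 ≤ len x
  · rw [if_pos h2, repr_klC, Finsupp.single_apply]
    simp [h2]
  · simp [h2]

/-! ### Integrality of products and the a-function -/

/-- The integral combinations of the `C_w` with `w` ending in `s`. -/
def endSpan (s : Fin 2) : AddSubgroup Hecke :=
  AddSubgroup.closure (klC '' {w | len (w * gen s) < len w})

theorem klC_mem_endSpan {s : Fin 2} {w : AffineWeyl} (h : len (w * gen s) < len w) :
    klC w ∈ endSpan s := AddSubgroup.subset_closure ⟨w, h, rfl⟩

theorem mulC_klC_mem_endSpan {s : Fin 2} {w : AffineWeyl} (h : len w < len (w * gen s)) :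
    mulC s (klC w) ∈ endSpan s := by
  rw [mulC_klC_of_gt h]
  refine add_mem (klC_mem_endSpan (by rwa [mul_gen_mul_gen])) ?_
  split_ifs with h2
  · exact klC_mem_endSpan (prev_descent h h2)
  · exact zero_mem _

/-- An element ending in s does not end in t, so the factor v + v⁻¹ never appears. -/
theorem mulC_mem_endSpan {s t : Fin 2} (hst : s ≠ t) {a : Hecke} (ha : a ∈ endSpan s) :
    mulC t a ∈ endSpan t := by
  induction ha using AddSubgroup.closure_induction with
  | mem a ha =>
    obtain ⟨w, hw, rfl⟩ := ha
    have hw' : len (w * gen s) < len w := hw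
    refine mulC_klC_mem_endSpan ?_
    have h1 := len_mul_gen w t
    by_contra hc
    exact hst (descent_unique hw' (by omega))
  | zero => simp
  | add a b _ _ ha hb => rw [map_add]; exact add_mem ha hb
  | neg a _ ha => rw [map_neg]; exact neg_mem ha

theorem repr_of_mem_endSpan {s : Fin 2} {a : Hecke} (ha : a ∈ endSpan s) (z : AffineWeyl) :
    ∃ m : ℤ, klBasis.repr a z = LaurentPolynomial.C m ∧ (z = 1 → m = 0) := by
  classical
  induction ha using AddSubgroup.closure_induction with
  | mem a ha =>
    obtain ⟨w, hw, rfl⟩ := ha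
    refine ⟨if w = z then 1 else 0, ?_, ?_⟩
    · rw [repr_klC, Finsupp.single_apply]
      split_ifs <;> simp
    · rintro rfl
      rw [if_neg]
      rintro rfl
      exact len_one_mul_gen s hw
  | zero => exact ⟨0, by simp, fun _ => rfl⟩
  | add a b _ _ ha hb =>
    obtain ⟨m, hm, hm'⟩ := ha
    obtain ⟨n, hn, hn'⟩ := hb
    refine ⟨m + n, by rw [map_add, Finsupp.add_apply, hm, hn, map_add], fun h => ?_⟩
    rw [hm' h, hn' h, add_zero]
  | neg a _ ha =>
    obtain ⟨m, hm, hm'⟩ := ha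
    refine ⟨-m, by rw [map_neg, Finsupp.neg_apply, hm, map_neg], fun h => ?_⟩
    rw [hm' h, neg_zero]

theorem exists_mulC_klC (x : AffineWeyl) (s : Fin 2) :
    ∃ c : Coeff, (c = 1 ∨ c = -(qHalf 1 + qHalf (-1))) ∧
      ∃ m ∈ endSpan s, mulC s (klC x) = c • m := by
  rcases len_mul_gen x s with h | h
  · exact ⟨1, Or.inl rfl, _, mulC_klC_mem_endSpan (by omega), (one_smul _ _).symm⟩
  · exact ⟨_, Or.inr rfl, _, klC_mem_endSpan (by omega), mulC_klC_of_lt (by omega)⟩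

/-- The product `C_x C_y` is `1` or `-(q^{1/2} + q^{-1/2})` times an integral combination of
elements `C_z` with `z ≠ 1`. -/
theorem exists_mul_klC (x : AffineWeyl) {ε : ℤ} (hε : ε = 1 ∨ ε = -1) :
    ∃ c : Coeff, (c = 1 ∨ c = -(qHalf 1 + qHalf (-1))) ∧
      ∀ n : ℕ, ∀ y, pos y = ε * (n + 1) → ∀ s, len (y * gen s) < len y →
        ∃ m ∈ endSpan s, mulLeft (klC x) (klC y) = c • m := by
  have hgen : ∀ s : Fin 2, len (gen s * gen s) < len (gen s) := by
    intro s
    rw [gen_mul_gen, len_one, len_gen]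
    omega
  obtain ⟨t, ht⟩ : ∃ t : Fin 2, pos (gen t) = ε := by
    rcases hε with rfl | rfl
    · exact ⟨0, rfl⟩
    · exact ⟨1, rfl⟩
  -- Only the first letter t of y can produce the factor v + v⁻¹, so c is fixed before the induction
  -- on length.
  obtain ⟨c, hc, m, hm, hcm⟩ := exists_mulC_klC x t
  refine ⟨c, hc, fun n => ?_⟩
  induction n using Nat.strong_induction_on with
  | _ n ih =>
    intro y hy s hs
    rcases Nat.eq_zero_or_pos n with rfl | hn
    · have hyt : y = gen t := pos_injective (by rw [hy, ht]; simp)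
      subst hyt
      obtain rfl := descent_unique hs (hgen t)
      exact ⟨m, hm, by rw [mul_klC_gen, hcm]⟩
    · have hly : len y = n + 1 := by
        rw [len_eq, hy]; rcases hε with rfl | rfl <;> omega
      have hlw := len_mul_gen y s
      have hw : pos (y * gen s) = ε * (((n - 1 : ℕ) : ℤ) + 1) := by
        have h1 := pos_mul_gen y s
        rw [len_eq, len_eq] at hs
        rw [Nat.cast_sub hn]
        rcases hε with rfl | rfl <;> split_ifs at h1 <;> push_cast <;> omega
      have hgt : len (y * gen s) < len (y * gen s * gen s) := by rwa [mul_gen_mul_gen]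
      have hdesc : ∀ r, len (y * gen s * gen r) < len (y * gen s) → r ≠ s := by
        rintro r hr rfl
        omega
      obtain ⟨r, hr⟩ := exists_len_mul_gen_lt (w := y * gen s)
        (fun h => by rw [h, len_one] at hlw; omega)
      obtain ⟨m₁, hm₁, hcm₁⟩ := ih (n - 1) (by omega) _ hw r hr
      -- Here C_y is C_{ys} C_s minus the preceding element, the latter absent when ℓ(y) = 2; hence
      -- strong induction. The combination for ys ends in r ≠ s, so multiplying by C_s keeps it
      -- integral.
      have hmul := congrArg (mulLeft (klC x)) (mulC_klC_of_gt hgt)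
      rw [mul_mulC, mul_gen_mul_gen, map_add, hcm₁, map_smul] at hmul
      have hm₁' := mulC_mem_endSpan (hdesc r hr) hm₁
      by_cases h2 : 2 ≤ len (y * gen s)
      · rw [if_pos h2] at hmul
        have hp : pos (prev (y * gen s)) = ε * (((n - 2 : ℕ) : ℤ) + 1) := by
          rw [prev, pos_ofPos, hw, Nat.cast_sub (by omega), Nat.cast_sub (by omega)]
          rcases hε with rfl | rfl
          · rw [Int.sign_eq_one_of_pos (by omega)]; push_cast; ring
          · rw [Int.sign_eq_neg_one_of_neg (by omega)]; push_cast; ring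
        obtain ⟨m₂, hm₂, hcm₂⟩ := ih (n - 2) (by omega) _ hp s (prev_descent hgt h2)
        refine ⟨mulC s m₁ - m₂, sub_mem hm₁' hm₂, ?_⟩
        rw [smul_sub, hmul, hcm₂, add_sub_cancel_right]
      · rw [if_neg h2, map_zero, add_zero] at hmul
        exact ⟨_, hm₁', hmul.symm⟩

theorem structConst_eq (x z : AffineWeyl) {y : AffineWeyl} (hy : y ≠ 1) :
    ∃ m : ℤ, (z = 1 → m = 0) ∧ (structConst x y z = LaurentPolynomial.C m ∨
      structConst x y z = -(qHalf 1 + qHalf (-1)) * LaurentPolynomial.C m) := by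
  obtain ⟨s, hs⟩ := exists_len_mul_gen_lt hy
  have h0 : pos y ≠ 0 := mt pos_eq_zero.1 hy
  obtain ⟨ε, hε, n, hn⟩ : ∃ ε : ℤ, (ε = 1 ∨ ε = -1) ∧ ∃ n : ℕ, pos y = ε * (n + 1) := by
    rcases lt_or_gt_of_ne h0 with h | h
    · exact ⟨-1, Or.inr rfl, (-pos y - 1).toNat, by omega⟩
    · exact ⟨1, Or.inl rfl, (pos y - 1).toNat, by omega⟩
  obtain ⟨c, hc, h⟩ := exists_mul_klC x hε
  obtain ⟨m, hm, hcm⟩ := h n y hn s hs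
  obtain ⟨k, hk, hk'⟩ := repr_of_mem_endSpan hm z
  refine ⟨k, hk', ?_⟩
  rw [structConst, mul_eq_mulLeft, hcm, map_smul, Finsupp.smul_apply, hk, smul_eq_mul]
  rcases hc with rfl | rfl
  · left; rw [one_mul]
  · right; rfl

theorem coeff_C_mul_qHalf (m k n : ℤ) :
    (LaurentPolynomial.C m * qHalf k : Coeff).coeff n = if k = n then m else 0 := by
  rw [qHalf, ← LaurentPolynomial.single_eq_C_mul_T, AddMonoidAlgebra.coeff_single,
    Finsupp.single_apply]

theorem aFun_one : aFun 1 = 0 := by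
  refine Nat.sInf_eq_zero.2 (Or.inl fun x y k hk => ?_)
  rw [pow_zero, one_mul]
  by_cases hy : y = 1
  · subst hy
    rw [structConst_one]
    split_ifs
    · have := coeff_C_mul_qHalf 1 0 k
      simp only [qHalf, LaurentPolynomial.T_zero, map_one, one_mul] at this
      rw [this, if_neg (by omega)]
    · rfl
  · obtain ⟨m, hm, h⟩ := structConst_eq x 1 hy
    have h0 : structConst x y 1 = 0 := by
      rcases h with h | h <;> simp [h, hm rfl]
    rw [h0]
    rfl

theorem aFun_of_ne_one {z : AffineWeyl} (hz : z ≠ 1) : aFun z = 1 := by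
  have hmem : 1 ∈ {n | ∀ x y, ∀ k < 0, ((-qHalf 1) ^ n * structConst x y z).coeff k = 0} := by
    intro x y k hk
    rw [pow_one]
    obtain ⟨m, h⟩ : ∃ m : ℤ, structConst x y z = LaurentPolynomial.C m ∨
      structConst x y z = -(qHalf 1 + qHalf (-1)) * LaurentPolynomial.C m := by
      by_cases hy : y = 1
      · subst hy
        refine ⟨if x = z then 1 else 0, Or.inl ?_⟩
        rw [structConst_one]
        split_ifs <;> simp
      · obtain ⟨m, -, h⟩ := structConst_eq x z hy
        exact ⟨m, h⟩
    rcases h with h | h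
    · rw [h, show -qHalf 1 * LaurentPolynomial.C m = LaurentPolynomial.C (-m) * qHalf 1 by
        rw [map_neg]; ring, coeff_C_mul_qHalf, if_neg (by omega)]
    · have e : -qHalf 1 * (-(qHalf 1 + qHalf (-1)) * LaurentPolynomial.C m) =
          LaurentPolynomial.C m * qHalf 2 + LaurentPolynomial.C m * qHalf 0 := by
        have h1 : (qHalf 2 : Coeff) = qHalf 1 * qHalf 1 := by
          rw [← LaurentPolynomial.T_add]; rfl
        have h2 : (qHalf 0 : Coeff) = qHalf 1 * qHalf (-1) := by
          rw [← LaurentPolynomial.T_add]; rfl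
        rw [h1, h2]
        ring
      rw [h, e, AddMonoidAlgebra.coeff_add, Finsupp.add_apply, coeff_C_mul_qHalf,
        coeff_C_mul_qHalf, if_neg (by omega), if_neg (by omega), add_zero]
  refine le_antisymm (Nat.sInf_le hmem) ?_
  · rw [Nat.one_le_iff_ne_zero]
    intro h
    have h0 := Nat.sInf_mem ⟨1, hmem⟩
    rw [show sInf _ = 0 from h] at h0
    -- For the right descent s of z, C_z C_s = -(v + v⁻¹)C_z has a pole, which excludes the exponent
    -- 0.
    obtain ⟨s, hs⟩ := exists_len_mul_gen_lt hz
    have h1 := h0 z (gen s) (-1) (by omega)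
    rw [pow_zero, one_mul, structConst_gen_of_lt hs, if_pos rfl] at h1
    have e : -(qHalf 1 + qHalf (-1)) =
        LaurentPolynomial.C (-1) * qHalf 1 + LaurentPolynomial.C (-1) * qHalf (-1) := by
      rw [map_neg, map_one]; ring
    rw [e, AddMonoidAlgebra.coeff_add, Finsupp.add_apply, coeff_C_mul_qHalf,
        coeff_C_mul_qHalf] at h1
    simp at h1

/-! ### The map `φ` in coordinates -/

theorem toSeries_add (c d : Coeff) : toSeries (c + d) = toSeries c + toSeries d := by
  ext k
  simp [toSeries]

theorem toSeries_neg (c : Coeff) : toSeries (-c) = -toSeries c := by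
  ext k
  simp [toSeries]

theorem toSeries_zero : toSeries 0 = 0 := by
  ext k
  simp [toSeries]

theorem toSeries_qHalf (n : ℤ) : toSeries (qHalf n) = HahnSeries.single n 1 := by
  ext k
  change (qHalf n).coeff k = _
  rw [LaurentPolynomial.T_apply, HahnSeries.coeff_single]
  split_ifs <;> first | rfl | omega

theorem toSeries_one : toSeries 1 = 1 := by
  rw [← LaurentPolynomial.T_zero]
  exact toSeries_qHalf 0

theorem eq_iff_pos_eq {x z : AffineWeyl} : x = z ↔ pos x = pos z := pos_injective.eq_iff.symm

/-- An x ≠ 1 has one descent, giving the diagonal term, and one ascent, giving the neighbours other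
than 1; for x = 1 each reflection gives one neighbour. The formula fails at z = 1, since C_s C_t has
no C_1 component. -/
theorem structConst_gen_add (x : AffineWeyl) {z : AffineWeyl} (hz : z ≠ 1) :
    structConst x (gen 0) z + structConst x (gen 1) z =
      if x = z then -(qHalf 1 + qHalf (-1)) else if (pos x - pos z).natAbs = 1 then 1 else 0 := by
  have hz0 : pos z ≠ 0 := mt pos_eq_zero.1 hz
  have p0 := pos_mul_gen x 0
  have p1 := pos_mul_gen x 1
  simp only [Fin.val_zero, Fin.val_one, Nat.cast_zero, Nat.cast_one, add_zero] at p0 p1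
  have l0 := len_eq (x * gen 0)
  have l1 := len_eq (x * gen 1)
  have lx := len_eq x
  have hp : pos (prev x) = pos x - (pos x).sign := by rw [prev, pos_ofPos]
  rcases lt_trichotomy (pos x) 0 with h | h | h
  · rw [Int.sign_eq_neg_one_of_neg h] at hp
    rcases Int.emod_two_eq_zero_or_one (pos x) with h2 | h2
    · rw [if_pos h2] at p0
      rw [if_neg (by omega)] at p1
      rw [structConst_gen_of_lt (by omega), structConst_gen_of_gt (by omega)]
      simp only [eq_iff_pos_eq, p1, hp]
      split_ifs <;> first | omega | simp
    · rw [if_neg (by omega)] at p0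
      rw [if_pos (by omega)] at p1
      rw [structConst_gen_of_gt (by omega), structConst_gen_of_lt (by omega)]
      simp only [eq_iff_pos_eq, p0, hp]
      split_ifs <;> first | omega | simp
  · rw [if_pos (by omega)] at p0
    rw [if_neg (by omega)] at p1
    rw [structConst_gen_of_gt (by omega), structConst_gen_of_gt (by omega)]
    simp only [eq_iff_pos_eq, p0, p1]
    split_ifs <;> first | omega | simp
  · rw [Int.sign_eq_one_of_pos h] at hp
    rcases Int.emod_two_eq_zero_or_one (pos x) with h2 | h2
    · rw [if_pos h2] at p0
      rw [if_neg (by omega)] at p1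
      rw [structConst_gen_of_gt (by omega), structConst_gen_of_lt (by omega)]
      simp only [eq_iff_pos_eq, p0, hp]
      split_ifs <;> first | omega | simp
    · rw [if_neg (by omega)] at p0
      rw [if_pos (by omega)] at p1
      rw [structConst_gen_of_lt (by omega), structConst_gen_of_gt (by omega)]
      simp only [eq_iff_pos_eq, p1, hp]
      split_ifs <;> first | omega | simp

theorem filter_distInv_one : (distInv.filter fun d => aFun d = aFun 1) = {1} := by
  ext d
  simp only [distInv, Finset.mem_filter, Finset.mem_insert, Finset.mem_singleton, aFun_one]
  constructor
  · rintro ⟨-, h⟩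
    by_contra hd
    rw [aFun_of_ne_one hd] at h
    omega
  · rintro rfl
    exact ⟨Or.inl rfl, aFun_one⟩

theorem filter_distInv_of_ne_one {z : AffineWeyl} (hz : z ≠ 1) :
    (distInv.filter fun d => aFun d = aFun z) = {gen 0, gen 1} := by
  ext d
  simp only [distInv, Finset.mem_filter, Finset.mem_insert, Finset.mem_singleton,
    aFun_of_ne_one hz]
  constructor
  · rintro ⟨rfl | h, h'⟩
    · rw [aFun_one] at h'
      omega
    · exact h
  · intro h
    refine ⟨Or.inr h, ?_⟩
    rcases h with rfl | rfl <;> exact aFun_of_ne_one (gen_ne_one _)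

theorem phi_one (b : AffineWeyl → LaurentSeries ℤ) : phi b 1 = b 1 := by
  unfold phi
  simp only [filter_distInv_one, Finset.sum_singleton, structConst_one]
  rw [finsum_eq_single _ 1]
  · rw [if_pos rfl, toSeries_one, mul_one]
  · intro x hx
    rw [if_neg hx, toSeries_zero, mul_zero]

/-- Only z and its two neighbours contribute, so the `finsum` has finite support for every family b.
-/
theorem phi_ofPos (b : AffineWeyl → LaurentSeries ℤ) {k : ℤ} (hk : k ≠ 0) :
    phi b (ofPos k) = b (ofPos (k + 1)) + b (ofPos (k - 1)) -
      b (ofPos k) * (HahnSeries.single 1 1 + HahnSeries.single (-1) 1) := by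
  have hz : ofPos k ≠ 1 := fun h => hk (by simpa using congrArg pos h)
  have h01 : gen 0 ≠ gen 1 := fun h => by simpa using congrArg pos h
  have hs (x : AffineWeyl) : ∑ d ∈ distInv with aFun d = aFun (ofPos k),
      b x * toSeries (structConst x d (ofPos k)) =
      b x * toSeries (if x = ofPos k then -(qHalf 1 + qHalf (-1)) else
        if (pos x - k).natAbs = 1 then 1 else 0) := by
    have h := structConst_gen_add x hz
    rw [pos_ofPos] at h
    rw [filter_distInv_of_ne_one hz, Finset.sum_pair h01, ← mul_add, ← toSeries_add, h]
  unfold phi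
  simp only [hs]
  have hinj : Function.Injective ofPos := posEquiv.symm.injective
  rw [finsum_eq_sum_of_support_subset (s := ({k + 1, k - 1, k} : Finset ℤ).image ofPos)]
  · rw [Finset.sum_image hinj.injOn, Finset.sum_insert (by simp; omega),
      Finset.sum_insert (by simp), Finset.sum_singleton]
    simp only [hinj.eq_iff, pos_ofPos]
    rw [if_neg (by omega), if_pos (by omega), if_neg (by omega), if_pos (by omega), if_pos trivial,
      toSeries_one, toSeries_neg, toSeries_add, toSeries_qHalf, toSeries_qHalf]
    ring
  · intro x hx
    rw [Function.mem_support] at hx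
    rw [Finset.coe_image]
    refine ⟨pos x, ?_, ofPos_pos x⟩
    by_contra hc
    apply hx
    simp only [Finset.coe_insert, Finset.coe_singleton, Set.mem_insert_iff,
      Set.mem_singleton_iff] at hc
    rw [if_neg (fun h => by rw [h, pos_ofPos] at hc; omega), if_neg (by omega), toSeries_zero,
      mul_zero]

/-! ### Uniqueness of preimages -/

/-- A solution of the recursion `b_{n+2} + b_n = (v + v⁻¹) b_{n+1}` which tends to zero and
vanishes at the origin is zero. -/
theorem eq_zero_of_recursion (b : ℕ → LaurentSeries ℤ) (h0 : b 0 = 0)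
    (hrec : ∀ n, b (n + 2) + b n =
      b (n + 1) * (HahnSeries.single 1 1 + HahnSeries.single (-1) 1))
    (hb : ∀ N : ℤ, ∃ L : ℕ, ∀ n, L ≤ n → ∀ k < N, (b n).coeff k = 0) (n : ℕ) : b n = 0 := by
  set v : LaurentSeries ℤ := HahnSeries.single 1 1 with hv
  set v' : LaurentSeries ℤ := HahnSeries.single (-1) 1 with hv'
  have hvv : v * v' = 1 := by
    rw [hv, hv', HahnSeries.single_mul_single]
    simp
  -- The operator factors with roots v and v⁻¹; removing the root v leaves a geometric sequence of
  -- ratio v⁻¹.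
  have hc (n : ℕ) : b (n + 1) - v * b n = HahnSeries.single (-(n : ℤ)) 1 * b 1 := by
    induction n with
    | zero => simp [h0]
    | succ n ih =>
      have e : HahnSeries.single (-((n + 1 : ℕ) : ℤ)) (1 : ℤ) =
          v' * HahnSeries.single (-(n : ℤ)) 1 := by
        rw [hv', HahnSeries.single_mul_single, one_mul,
          show -((n + 1 : ℕ) : ℤ) = -1 + -(n : ℤ) by push_cast; ring]
      rw [e, mul_assoc, ← ih]
      linear_combination hrec n + b n * hvv
  have h1 : b 1 = 0 := by
    ext k
    -- The coefficient of v^{k-L} in v^{-L} b_1 is the k-th coefficient of b_1, while on the other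
    -- side it vanishes because b tends to zero.
    obtain ⟨L, hL⟩ := hb (k + 1)
    have := congrArg (fun f : LaurentSeries ℤ => f.coeff (k - L)) (hc L)
    simp only [HahnSeries.coeff_sub, hv, HahnSeries.coeff_single_mul, one_mul] at this
    rw [hL (L + 1) (by omega) _ (by omega), hL L le_rfl _ (by omega), sub_neg_eq_add,
      sub_add_cancel] at this
    rw [← this]
    simp
  induction n with
  | zero => exact h0
  | succ n ih =>
    have := hc n
    rw [ih, h1, mul_zero, mul_zero, sub_zero] at this
    exact this

/-! ### Existence and uniqueness of preimages -/

/-- Additivity is read off the coordinate formulas, so no convergence condition enters. -/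
theorem phi_jHat_add (a a' : AffineWeyl → LaurentSeries ℤ) :
    phi (jHat (a + a')) = phi (jHat a) + phi (jHat a') := by
  funext z
  rw [← ofPos_pos z]
  by_cases h : pos z = 0
  · rw [pos_eq_zero.1 h]
    change phi _ (ofPos (pos 1)) = phi _ (ofPos (pos 1)) + phi _ (ofPos (pos 1))
    rw [ofPos_pos, phi_one, phi_one, phi_one]
    simp only [jHat, Pi.add_apply]
    ring
  · rw [Pi.add_apply, phi_ofPos _ h, phi_ofPos _ h, phi_ofPos _ h]
    simp only [jHat, Pi.add_apply]
    ring

/-- The composition of `φ` and `j` as an additive map on families of coefficients. -/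
def phiJ : (AffineWeyl → LaurentSeries ℤ) →+ (AffineWeyl → LaurentSeries ℤ) :=
  AddMonoidHom.mk' (fun a => phi (jHat a)) phi_jHat_add

/-- The completed Hecke algebra, as the group of families of coefficients tending to zero. -/
def nullFamilies : AddSubgroup (AffineWeyl → LaurentSeries ℤ) where
  carrier := {a | TendsToZero a}
  zero_mem' := fun N => ⟨0, fun x _ k _ => rfl⟩
  add_mem' := by
    intro a b ha hb N
    obtain ⟨L, hL⟩ := ha N
    obtain ⟨L', hL'⟩ := hb N
    refine ⟨max L L', fun x hx k hk => ?_⟩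
    rw [Pi.add_apply, HahnSeries.coeff_add, hL x (by omega) k hk, hL' x (by omega) k hk, add_zero]
  neg_mem' := by
    intro a ha N
    obtain ⟨L, hL⟩ := ha N
    refine ⟨L, fun x hx k hk => ?_⟩
    rw [Pi.neg_apply, HahnSeries.coeff_neg, hL x hx k hk, neg_zero]

theorem neg_one_pow_mul_coeff (m : ℕ) (f : LaurentSeries ℤ) (k : ℤ) :
    ((-1) ^ m * f).coeff k = (-1) ^ m * f.coeff k := by
  rcases neg_one_pow_eq_or (LaurentSeries ℤ) m with h | h
  · rcases Nat.even_or_odd m with h' | h'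
    · rw [h'.neg_one_pow, h'.neg_one_pow, one_mul, one_mul]
    · rw [h'.neg_one_pow, h'.neg_one_pow, neg_one_mul, neg_one_mul, HahnSeries.coeff_neg]
  · rcases Nat.even_or_odd m with h' | h'
    · rw [h'.neg_one_pow, h'.neg_one_pow, one_mul, one_mul]
    · rw [h'.neg_one_pow, h'.neg_one_pow, neg_one_mul, neg_one_mul, HahnSeries.coeff_neg]

theorem eq_zero_of_phiJ_eq_zero {a : AffineWeyl → LaurentSeries ℤ} (ha : TendsToZero a)
    (h : phiJ a = 0) : a = 0 := by
  -- The component of φ at 1 gives the vanishing at the origin, so the two rays decouple and each is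
  -- a one-sided recursion.
  have key (σ : ℤ) (hσ : σ = 1 ∨ σ = -1) (n : ℕ) : jHat a (ofPos (σ * n)) = 0 := by
    refine eq_zero_of_recursion (fun n : ℕ => jHat a (ofPos (σ * n))) ?_ ?_ ?_ n
    · have h1 := congrFun h 1
      change phi (jHat a) 1 = 0 at h1
      rw [phi_one] at h1
      rw [Nat.cast_zero, mul_zero]
      exact h1
    · intro n
      have h1 := congrFun h (ofPos (σ * (n + 1 : ℕ)))
      change phi (jHat a) _ = 0 at h1
      rw [phi_ofPos _ (by rcases hσ with rfl | rfl <;> omega)] at h1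
      rcases hσ with rfl | rfl
      · rw [show (1 : ℤ) * (n + 1 : ℕ) + 1 = 1 * (n + 2 : ℕ) by push_cast; ring,
          show (1 : ℤ) * (n + 1 : ℕ) - 1 = 1 * n by push_cast; ring] at h1
        exact sub_eq_zero.1 h1
      · rw [show (-1 : ℤ) * (n + 1 : ℕ) + 1 = -1 * n by push_cast; ring,
          show (-1 : ℤ) * (n + 1 : ℕ) - 1 = -1 * (n + 2 : ℕ) by push_cast; ring,
          add_comm] at h1
        exact sub_eq_zero.1 h1
    · intro N
      obtain ⟨L, hL⟩ := ha N
      refine ⟨L, fun n hn k hk => ?_⟩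
      rw [jHat, neg_one_pow_mul_coeff, hL _ _ k hk, mul_zero]
      rw [len_ofPos]
      rcases hσ with rfl | rfl <;> omega
  funext x
  have hx : jHat a x = 0 := by
    rw [← ofPos_pos x]
    rcases le_total 0 (pos x) with h0 | h0
    · have := key 1 (Or.inl rfl) (pos x).natAbs
      rwa [show 1 * ((pos x).natAbs : ℤ) = pos x by omega] at this
    · have := key (-1) (Or.inr rfl) (pos x).natAbs
      rwa [show -1 * ((pos x).natAbs : ℤ) = pos x by omega] at this
  exact (mul_eq_zero.1 hx).resolve_left (pow_ne_zero _ (neg_ne_zero.2 one_ne_zero))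

/-- The family with coefficients `(-1)^{ℓ(x)} v^{ℓ(x) + c}` at the elements `x` on the ray of
direction `σ` of length at least `k`. -/
def rayFamily (σ : ℤ) (k : ℕ) (c : ℤ) (x : AffineWeyl) : LaurentSeries ℤ :=
  if (k : ℤ) ≤ σ * pos x then (-1) ^ len x * HahnSeries.single (len x + c) 1 else 0

theorem rayFamily_mem (σ : ℤ) (k : ℕ) (c : ℤ) : rayFamily σ k c ∈ nullFamilies := by
  intro N
  refine ⟨(N - c).toNat, fun x hx m hm => ?_⟩
  unfold rayFamily
  split_ifs
  · rw [neg_one_pow_mul_coeff, HahnSeries.coeff_single_of_ne (by omega), mul_zero]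
  · rfl

theorem jHat_rayFamily (σ : ℤ) (k : ℕ) (c z : ℤ) :
    jHat (rayFamily σ k c) (ofPos z) =
      if (k : ℤ) ≤ σ * z then HahnSeries.single (z.natAbs + c) 1 else 0 := by
  rw [jHat, rayFamily, len_ofPos, pos_ofPos]
  split_ifs
  · rw [← mul_assoc, ← mul_pow, neg_one_mul, neg_neg, one_pow, one_mul]
  · rw [mul_zero]

theorem phiJ_rayFamily_one (σ : ℤ) (k : ℕ) (c : ℤ) :
    phiJ (rayFamily σ k c) 1 = if k = 0 then HahnSeries.single c 1 else 0 := by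
  change phi _ 1 = _
  have h := jHat_rayFamily σ k c (pos 1)
  rw [ofPos_pos] at h
  rw [phi_one, h]
  simp

/-- The powers of v solve the recursion, so only the cut at k leaves a defect, at k - 1 and at k. -/
theorem phiJ_rayFamily (σ : ℤ) (hσ : σ = 1 ∨ σ = -1) (k : ℕ) (c : ℤ) {z : ℤ} (hz : z ≠ 0) :
    phiJ (rayFamily σ k c) (ofPos z) =
      (if σ * z = k - 1 then HahnSeries.single (k + c) 1 else 0) -
        if σ * z = k then HahnSeries.single (k - 1 + c) 1 else 0 := by
  change phi _ _ = _
  rw [phi_ofPos _ hz]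
  simp only [jHat_rayFamily]
  have hs (m n : ℤ) : (HahnSeries.single m 1 : LaurentSeries ℤ) * HahnSeries.single n 1 =
      HahnSeries.single (m + n) 1 := by
    rw [HahnSeries.single_mul_single, one_mul]
  -- Z = σz is the coordinate along the ray. On the negative ray the two neighbours exchange roles.
  have key (Z z₁ z₂ : ℤ) (hZ : Z ≠ 0) (h : z.natAbs = Z.natAbs) (h₁ : z₁.natAbs = (Z + 1).natAbs)
      (h₂ : z₂.natAbs = (Z - 1).natAbs) :
      (if (k : ℤ) ≤ Z + 1 then (HahnSeries.single (z₁.natAbs + c) 1 : LaurentSeries ℤ) else 0) +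
        (if (k : ℤ) ≤ Z - 1 then HahnSeries.single (z₂.natAbs + c) 1 else 0) -
        (if (k : ℤ) ≤ Z then HahnSeries.single (z.natAbs + c) 1 else 0) *
          (HahnSeries.single 1 1 + HahnSeries.single (-1) 1) =
      (if Z = k - 1 then HahnSeries.single (k + c) 1 else 0) -
        if Z = k then HahnSeries.single (k - 1 + c) 1 else 0 := by
    rw [h, h₁, h₂]
    rcases lt_trichotomy Z k with h | h | h
    · rw [if_neg (show ¬ (k : ℤ) ≤ Z - 1 by omega), if_neg (show ¬ (k : ℤ) ≤ Z by omega),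
        if_neg (show ¬ Z = k by omega)]
      by_cases h' : Z = k - 1
      · rw [if_pos (by omega), if_pos h', show ((Z + 1).natAbs : ℤ) = k by omega]
        ring
      · rw [if_neg (by omega), if_neg h']
        ring
    · rw [if_pos (by omega), if_neg (by omega), if_pos (by omega), if_neg (by omega), if_pos h,
        mul_add, hs, hs, show ((Z + 1).natAbs : ℤ) + c = (Z.natAbs : ℤ) + c + 1 by omega,
        show (k : ℤ) - 1 + c = (Z.natAbs : ℤ) + c + -1 by omega]
      ring
    · rw [if_pos (by omega), if_pos (by omega), if_pos (by omega), if_neg (by omega),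
        if_neg (by omega), mul_add, hs, hs,
        show ((Z + 1).natAbs : ℤ) + c = (Z.natAbs : ℤ) + c + 1 by omega,
        show ((Z - 1).natAbs : ℤ) + c = (Z.natAbs : ℤ) + c + -1 by omega]
      ring
  rcases hσ with rfl | rfl
  · have := key z (z + 1) (z - 1) hz rfl rfl rfl
    simpa only [one_mul] using this
  · have := key (-z) (z - 1) (z + 1) (by omega) (by omega) (by omega) (by omega)
    rw [show (-1 : ℤ) * z = -z by ring, show (-1 : ℤ) * (z + 1) = -z - 1 by ring,
      show (-1 : ℤ) * (z - 1) = -z + 1 by ring]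
    rw [← this]
    ring

theorem sign_pos {y : AffineWeyl} (hy : y ≠ 1) : (pos y).sign = 1 ∨ (pos y).sign = -1 := by
  rcases lt_or_gt_of_ne (mt pos_eq_zero.1 hy) with h | h
  · exact Or.inr (Int.sign_eq_neg_one_of_neg h)
  · exact Or.inl (Int.sign_eq_one_of_pos h)

/-- The preimage of `t_y` under `φ ∘ j`. -/
def preimageT (y : AffineWeyl) : AffineWeyl → LaurentSeries ℤ :=
  if y = 1 then rayFamily 1 0 0 + rayFamily (-1) 1 0
  else -∑ k ∈ Finset.Icc 1 (len y), rayFamily (pos y).sign k (len y + 1 - 2 * k)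

theorem preimageT_mem (y : AffineWeyl) : preimageT y ∈ nullFamilies := by
  unfold preimageT
  split_ifs
  · exact add_mem (rayFamily_mem _ _ _) (rayFamily_mem _ _ _)
  · exact neg_mem (sum_mem fun k _ => rayFamily_mem _ _ _)

/-- With n = ℓ(y), the shift c = n + 1 - 2k makes the k-th ray contribute v^{n-k+1} at k - 1 and
-v^{n-k} at k. Consecutive defects cancel, and v⁰ = 1 survives at y. The defect of the first ray at
the origin is invisible, because φ has no neighbour terms there. -/
theorem phiJ_preimageT (y : AffineWeyl) : phiJ (preimageT y) = Pi.single y 1 := by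
  funext z
  by_cases hz : z = 1
  · subst hz
    by_cases hy : y = 1
    · subst hy
      rw [preimageT, if_pos rfl, map_add, Pi.add_apply, phiJ_rayFamily_one, phiJ_rayFamily_one,
        if_pos rfl, if_neg one_ne_zero, add_zero, Pi.single_eq_same]
      rfl
    · rw [preimageT, if_neg hy, map_neg, map_sum, Pi.neg_apply, Finset.sum_apply,
        Finset.sum_eq_zero, neg_zero, Pi.single_eq_of_ne (Ne.symm hy)]
      intro k hk
      rw [phiJ_rayFamily_one, if_neg]
      rw [Finset.mem_Icc] at hk
      omega
  · have hz0 : pos z ≠ 0 := mt pos_eq_zero.1 hz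
    obtain ⟨p, hp⟩ : ∃ p, p = pos z := ⟨_, rfl⟩
    rw [← hp] at hz0
    have hzp : z = ofPos p := by rw [hp, ofPos_pos]
    subst hzp
    by_cases hy : y = 1
    · subst hy
      rw [preimageT, if_pos rfl, map_add, Pi.add_apply, phiJ_rayFamily _ (Or.inl rfl) _ _ hz0,
        phiJ_rayFamily _ (Or.inr rfl) _ _ hz0, Pi.single_eq_of_ne hz]
      -- For y = 1 both rays have a defect at position -1, with opposite signs.
      have e1 : (1 * p = ((0 : ℕ) : ℤ) - 1) = (-1 * p = ((1 : ℕ) : ℤ)) := by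
        apply propext; omega
      rw [if_neg (show ¬ 1 * p = ((0 : ℕ) : ℤ) by omega),
        if_neg (show ¬ -1 * p = ((1 : ℕ) : ℤ) - 1 by omega)]
      simp only [e1]
      simp
    · have hy0 : pos y ≠ 0 := mt pos_eq_zero.1 hy
      have hσ := sign_pos hy
      rw [preimageT, if_neg hy, map_neg, map_sum, Pi.neg_apply, Finset.sum_apply]
      set g : ℕ → LaurentSeries ℤ := fun k => if (pos y).sign * p = k then
        HahnSeries.single ((len y : ℤ) - k) 1 else 0 with hg
      have hterm : ∀ k ∈ Finset.Icc 1 (len y),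
          phiJ (rayFamily (pos y).sign k (len y + 1 - 2 * k)) (ofPos p) = -(g k - g (k - 1)) := by
        intro k hk
        rw [Finset.mem_Icc] at hk
        rw [phiJ_rayFamily _ hσ _ _ hz0, hg]
        simp only [Nat.cast_sub hk.1, Nat.cast_one]
        rw [show (k : ℤ) + (len y + 1 - 2 * k) = len y - (k - 1) by ring,
          show (k : ℤ) - 1 + (len y + 1 - 2 * k) = len y - k by ring]
        ring
      rw [Finset.sum_congr rfl hterm, Finset.sum_neg_distrib, neg_neg]
      have htel : ∀ n, ∑ k ∈ Finset.Icc 1 n, (g k - g (k - 1)) = g n - g 0 := by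
        intro n
        induction n with
        | zero => simp
        | succ n ih =>
          rw [Finset.sum_Icc_succ_top (by omega), ih, Nat.add_sub_cancel]
          ring
      have hg0 : g 0 = 0 := by
        rw [hg]
        refine if_neg ?_
        rw [Nat.cast_zero]
        exact mul_ne_zero (by rcases hσ with h | h <;> omega) hz0
      rw [htel, hg0, sub_zero, hg, Pi.single_apply]
      have : ((pos y).sign * p = (len y : ℤ)) ↔ ofPos p = y := by
        rw [eq_iff_pos_eq, pos_ofPos, len_eq]
        rcases lt_or_gt_of_ne hy0 with h | h
        · rw [Int.sign_eq_neg_one_of_neg h]; omega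
        · rw [Int.sign_eq_one_of_pos h]; omega
      simp only [this, sub_self]
      rfl

theorem isPreimageT_iff (y : AffineWeyl) (a : AffineWeyl → LaurentSeries ℤ) :
    IsPreimageT y a ↔ a = preimageT y := by
  constructor
  · rintro ⟨h1, h2⟩
    have h3 : a - preimageT y ∈ nullFamilies := sub_mem (show a ∈ nullFamilies from h1)
      (preimageT_mem y)
    refine sub_eq_zero.1 (eq_zero_of_phiJ_eq_zero h3 ?_)
    rw [map_sub, phiJ_preimageT, sub_eq_zero]
    exact h2
  · rintro rfl
    exact ⟨preimageT_mem y, phiJ_preimageT y⟩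

/-! ### Coefficients of `T_w` -/

theorem jInv_apply (a : Hecke) (w : AffineWeyl) :
    jInv a w = LaurentPolynomial.invert (a w) * ((-1) ^ len w * qHalf (-2 * len w)) := by
  classical
  rw [jInv, Finsupp.sum_apply, Finsupp.sum, Finset.sum_eq_single w]
  · rw [Finsupp.single_eq_same]
  · intro x _ hx
    exact Finsupp.single_eq_of_ne (Ne.symm hx)
  · intro h
    rw [Finsupp.notMem_support_iff.1 h]
    simp

/-- The bar and the factor (-1)^{ℓ(w)} q^{-ℓ(w)} in j cancel all dependence on w ≤ x. -/
theorem klC'_apply (x w : AffineWeyl) :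
    klC' x w = if w ∈ lower x then qHalf (-(len x : ℤ)) else 0 := by
  rw [klC', Finsupp.smul_apply, jInv_apply, smul_eq_mul]
  split_ifs with h
  · rw [klC_apply_of_le h, map_mul, map_pow, map_neg, map_one, LaurentPolynomial.invert_T]
    have e : (qHalf (-((len x : ℤ) - 2 * len w)) * qHalf (-2 * len w) : Coeff) =
        qHalf (-(len x : ℤ)) := by
      rw [← LaurentPolynomial.T_add]
      congr 1
      ring
    have e2 : ((-1) ^ len x * (-1) ^ (len x + len w) * (-1) ^ len w : Coeff) = 1 := by
      rw [← pow_add, ← pow_add]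
      exact Even.neg_one_pow ⟨len x + len w, by ring⟩
    linear_combination (qHalf (-((len x : ℤ) - 2 * len w)) * qHalf (-2 * len w)) * e2 + e
  · rw [klC_apply, if_neg h, map_zero, zero_mul, mul_zero]

/-- The contribution of `a_x C'_x` to the coefficient of `T_w` in degree `m`. -/
def termCoeff (a : AffineWeyl → LaurentSeries ℤ) (w : AffineWeyl) (m : ℤ) (x : AffineWeyl) : ℤ :=
  if w ∈ lower x then (a x).coeff (m - len x) else 0

theorem tCoeff_eq (a : AffineWeyl → LaurentSeries ℤ) (w : AffineWeyl) (m : ℤ) :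
    tCoeff a w m = ∑ᶠ x, termCoeff a w m x := by
  unfold tCoeff termCoeff
  congr 1
  funext x
  rw [klC'_apply]
  split_ifs
  · rw [LaurentPolynomial.invert_T, neg_neg, toSeries_qHalf, HahnSeries.coeff_mul_single, mul_one]
  · rw [map_zero, toSeries_zero, mul_zero, HahnSeries.coeff_zero]

/-- The coefficient of `T_w` in `∑ a_x C'_x` is a well-defined series, with sum `s` at `u`. -/
structure HasValue (u : ℝ) (a : AffineWeyl → LaurentSeries ℤ) (w : AffineWeyl) (s : ℝ) : Prop where
  finite : ∀ m, (Function.support (termCoeff a w m)).Finite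
  hasSum : HasSum (fun m : ℤ => (tCoeff a w m : ℝ) * u ^ m) s

theorem termCoeff_add (a b : AffineWeyl → LaurentSeries ℤ) (w : AffineWeyl) (m : ℤ)
    (x : AffineWeyl) : termCoeff (a + b) w m x = termCoeff a w m x + termCoeff b w m x := by
  unfold termCoeff
  split_ifs <;> simp

theorem termCoeff_neg (a : AffineWeyl → LaurentSeries ℤ) (w : AffineWeyl) (m : ℤ)
    (x : AffineWeyl) : termCoeff (-a) w m x = -termCoeff a w m x := by
  unfold termCoeff
  split_ifs <;> simp

/-- The finiteness field is carried along because `finsum` takes the value 0 on infinite supports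
and is additive only on finite ones. -/
theorem HasValue.add {u : ℝ} {a b : AffineWeyl → LaurentSeries ℤ} {w : AffineWeyl} {s t : ℝ}
    (ha : HasValue u a w s) (hb : HasValue u b w t) : HasValue u (a + b) w (s + t) := by
  constructor
  · intro m
    refine ((ha.finite m).union (hb.finite m)).subset ?_
    intro x hx
    rw [Function.mem_support, termCoeff_add] at hx
    by_contra hc
    simp only [Set.mem_union, Function.mem_support, not_or, not_not] at hc
    rw [hc.1, hc.2] at hx
    exact hx rfl
  · convert! ha.hasSum.add hb.hasSum using 2 with m
    rw [tCoeff_eq, tCoeff_eq, tCoeff_eq]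
    simp only [termCoeff_add]
    rw [finsum_add_distrib (ha.finite m) (hb.finite m)]
    push_cast
    ring

theorem HasValue.neg {u : ℝ} {a : AffineWeyl → LaurentSeries ℤ} {w : AffineWeyl} {s : ℝ}
    (ha : HasValue u a w s) : HasValue u (-a) w (-s) := by
  constructor
  · intro m
    refine (ha.finite m).subset ?_
    intro x hx
    rw [Function.mem_support, termCoeff_neg] at hx
    exact fun h => hx (by rw [h, neg_zero])
  · convert! ha.hasSum.neg using 2 with m
    rw [tCoeff_eq, tCoeff_eq]
    simp only [termCoeff_neg]
    rw [finsum_neg_distrib]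
    push_cast
    ring

theorem HasValue.zero (u : ℝ) (w : AffineWeyl) : HasValue u 0 w 0 := by
  have h : ∀ m, termCoeff 0 w m = fun _ => 0 := by
    intro m
    funext x
    unfold termCoeff
    split_ifs <;> rfl
  constructor
  · intro m
    rw [h, Function.support_fun_zero]
    exact Set.finite_empty
  · simp only [tCoeff_eq, h, finsum_zero, Int.cast_zero, zero_mul]
    exact hasSum_zero

theorem HasValue.sum {u : ℝ} {w : AffineWeyl} (I : Finset ℕ)
    {a : ℕ → AffineWeyl → LaurentSeries ℤ} {s : ℕ → ℝ}
    (h : ∀ i ∈ I, HasValue u (a i) w (s i)) : HasValue u (∑ i ∈ I, a i) w (∑ i ∈ I, s i) := by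
  classical
  induction I using Finset.induction_on with
  | empty => exact HasValue.zero u w
  | insert i I hi ih =>
    rw [Finset.sum_insert hi, Finset.sum_insert hi]
    exact (h i (Finset.mem_insert_self i I)).add
      (ih fun j hj => h j (Finset.mem_insert_of_mem hj))

/-! ### Geometric series along a ray -/

/-- The least length of an element `x` on the ray of direction `σ` with `ℓ(x) ≥ k` and `w ≤ x`. -/
def threshold (σ : ℤ) (k : ℕ) (w : AffineWeyl) : ℕ :=
  if (k : ℤ) ≤ σ * pos w then len w else max k (len w + 1)

theorem mem_lower_ray_iff {σ : ℤ} (hσ : σ = 1 ∨ σ = -1) (k : ℕ) (w : AffineWeyl) (j : ℕ) :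
    k ≤ j ∧ w ∈ lower (ofPos (σ * j)) ↔ threshold σ k w ≤ j := by
  rw [mem_lower_iff, eq_iff_pos_eq, len_ofPos, pos_ofPos, threshold, len_eq]
  rcases hσ with rfl | rfl <;> split_ifs <;> omega

theorem termCoeff_rayFamily {σ : ℤ} (hσ : σ = 1 ∨ σ = -1) (k : ℕ) (c : ℤ) (w : AffineWeyl)
    (m : ℤ) (x : AffineWeyl) (hx : termCoeff (rayFamily σ k c) w m x ≠ 0) :
    m = 2 * (len x : ℤ) + c ∧ x = ofPos (σ * len x) := by
  unfold termCoeff rayFamily at hx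
  split_ifs at hx with h1 h2
  · rw [neg_one_pow_mul_coeff] at hx
    have h3 : m - len x = len x + c := by
      by_contra hc
      rw [HahnSeries.coeff_single_of_ne hc, mul_zero] at hx
      exact hx rfl
    refine ⟨by omega, ?_⟩
    rw [eq_iff_pos_eq, pos_ofPos, len_eq]
    rcases hσ with rfl | rfl <;> omega
  · simp at hx
  · simp at hx

/-- The element of length j has degree j + c from its coefficient and j from C'_x, so different
elements of the ray occupy different degrees. -/
theorem tCoeff_rayFamily {σ : ℤ} (hσ : σ = 1 ∨ σ = -1) (k : ℕ) (c : ℤ) (w : AffineWeyl)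
    (j : ℕ) : tCoeff (rayFamily σ k c) w (2 * j + c) =
      if threshold σ k w ≤ j then (-1) ^ j else 0 := by
  have hl : len (ofPos (σ * j)) = j := by
    rw [len_ofPos]
    rcases hσ with rfl | rfl <;> omega
  rw [tCoeff_eq, finsum_eq_single _ (ofPos (σ * j))]
  · unfold termCoeff rayFamily
    rw [hl, pos_ofPos]
    simp only [← mem_lower_ray_iff hσ]
    have e : (k : ℤ) ≤ σ * (σ * j) ↔ k ≤ j := by
      rcases hσ with rfl | rfl <;> omega
    simp only [e]
    by_cases h1 : w ∈ lower (ofPos (σ * j)) <;> by_cases h2 : k ≤ j <;>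
      simp only [h1, h2, if_true, if_false, and_self, and_true, and_false, HahnSeries.coeff_zero]
    rw [neg_one_pow_mul_coeff, show (2 * j + c - j : ℤ) = j + c by ring,
      HahnSeries.coeff_single_same, mul_one]
  · intro x hx
    by_contra hc
    obtain ⟨h1, h2⟩ := termCoeff_rayFamily hσ k c w _ x hc
    apply hx
    rw [h2]
    congr 2
    omega

theorem hasSum_ite_le_pow {r : ℝ} (hr : |r| < 1) (J : ℕ) :
    HasSum (fun j : ℕ => if J ≤ j then r ^ j else 0) (r ^ J / (1 - r)) := by
  have h := (hasSum_geometric_of_abs_lt_one hr).mul_left (r ^ J)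
  rw [← div_eq_mul_inv] at h
  have hinj : Function.Injective fun j : ℕ => j + J := add_left_injective J
  rw [← hinj.hasSum_iff]
  · convert! h using 2 with j
    simp [pow_add, mul_comm]
  · intro j hj
    rw [if_neg]
    intro hle
    exact hj ⟨j - J, Nat.sub_add_cancel hle⟩

theorem hasValue_rayFamily {u : ℝ} (hu : 0 < u) (hu1 : u < 1) {σ : ℤ} (hσ : σ = 1 ∨ σ = -1)
    (k : ℕ) (c : ℤ) (w : AffineWeyl) :
    HasValue u (rayFamily σ k c) w
      (u ^ c * ((-u ^ 2) ^ threshold σ k w / (1 + u ^ 2))) := by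
  constructor
  · intro m
    refine (Set.finite_singleton (ofPos (σ * ((m - c) / 2)))).subset fun x hx => ?_
    obtain ⟨h1, h2⟩ := termCoeff_rayFamily hσ k c w m x hx
    rw [Set.mem_singleton_iff, h2]
    congr 2
    omega
  · have hinj : Function.Injective fun j : ℕ => 2 * (j : ℤ) + c := by
      intro i j hij
      simp only at hij
      omega
    rw [← hinj.hasSum_iff]
    · have hr : |-u ^ 2| < 1 := by
        rw [abs_neg, abs_of_pos (by positivity)]
        exact pow_lt_one₀ hu.le hu1 two_ne_zero
      have h := (hasSum_ite_le_pow hr (threshold σ k w)).mul_left (u ^ c)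
      rw [sub_neg_eq_add] at h
      convert! h using 2 with j
      rw [Function.comp_apply, tCoeff_rayFamily hσ]
      split_ifs
      · rw [zpow_add₀ hu.ne', _root_.zpow_mul, zpow_natCast, neg_pow (u ^ 2)]
        push_cast
        norm_cast
        ring
      · simp
    · intro m hm
      rw [tCoeff_eq, finsum_eq_zero_of_forall_eq_zero, Int.cast_zero, zero_mul]
      intro x
      by_contra hc
      exact hm ⟨len x, (termCoeff_rayFamily hσ k c w m x hc).1.symm⟩

/-- The coefficient of `T_w` in `t_y`, evaluated at `u = q^{-1/2}`. -/
def valueT (u : ℝ) (y w : AffineWeyl) : ℝ :=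
  if y = 1 then u ^ (0 : ℤ) * ((-u ^ 2) ^ threshold 1 0 w / (1 + u ^ 2)) +
      u ^ (0 : ℤ) * ((-u ^ 2) ^ threshold (-1) 1 w / (1 + u ^ 2))
  else -∑ k ∈ Finset.Icc 1 (len y), u ^ ((len y : ℤ) + 1 - 2 * k) *
    ((-u ^ 2) ^ threshold (pos y).sign k w / (1 + u ^ 2))

theorem hasValue_preimageT {u : ℝ} (hu : 0 < u) (hu1 : u < 1) (y w : AffineWeyl) :
    HasValue u (preimageT y) w (valueT u y w) := by
  unfold preimageT valueT
  split_ifs with hy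
  · exact (hasValue_rayFamily hu hu1 (Or.inl rfl) _ _ _).add
      (hasValue_rayFamily hu hu1 (Or.inr rfl) _ _ _)
  · exact (HasValue.sum _ fun k _ => hasValue_rayFamily hu hu1 (sign_pos hy) _ _ _).neg

theorem len_le_threshold (σ : ℤ) (k : ℕ) (w : AffineWeyl) : len w ≤ threshold σ k w := by
  unfold threshold
  split_ifs <;> omega

/-- The coefficient of `T_w` in `t_y` is `O(q^{-ℓ(w)})`. -/
theorem exists_abs_valueT_le {u : ℝ} (hu : 0 < u) (hu1 : u < 1) (y : AffineWeyl) :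
    ∃ C : ℝ, 0 ≤ C ∧ ∀ w, |valueT u y w| ≤ C * (u ^ 2) ^ len w := by
  have key (c σ : ℤ) (k : ℕ) (w : AffineWeyl) :
      |u ^ c * ((-u ^ 2) ^ threshold σ k w / (1 + u ^ 2))| ≤ u ^ c * (u ^ 2) ^ len w := by
    rw [abs_mul, abs_of_pos (zpow_pos hu c), abs_div, abs_pow, abs_neg,
      abs_of_pos (show 0 < u ^ 2 by positivity), abs_of_pos (show 0 < 1 + u ^ 2 by positivity)]
    refine mul_le_mul_of_nonneg_left ?_ (zpow_pos hu c).le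
    refine (div_le_self (by positivity) (by nlinarith)).trans ?_
    exact pow_le_pow_of_le_one (by positivity) (pow_le_one₀ hu.le hu1.le) (len_le_threshold σ k w)
  unfold valueT
  split_ifs with hy
  · refine ⟨u ^ (0 : ℤ) + u ^ (0 : ℤ), by positivity, fun w => ?_⟩
    rw [add_mul]
    exact (abs_add_le _ _).trans (add_le_add (key _ _ _ _) (key _ _ _ _))
  · refine ⟨∑ k ∈ Finset.Icc 1 (len y), u ^ ((len y : ℤ) + 1 - 2 * k),
      Finset.sum_nonneg fun k _ => (zpow_pos hu _).le, fun w => ?_⟩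
    rw [abs_neg, Finset.sum_mul]
    exact (Finset.abs_sum_le_sum_abs _ _).trans (Finset.sum_le_sum fun k _ => key _ _ _ _)

/-- The three cases of c_k(w) are the starting points ℓ(w), ℓ(w) + 1 and k of the geometric series,
and starting with y_k means lying on the ray of y at distance at least k. -/
theorem valueT_eq_explicitCoeff {q : ℝ} (hq : 0 < q) {y : AffineWeyl} (hy : y ≠ 1)
    (w : AffineWeyl) : valueT (Real.sqrt q)⁻¹ y w = explicitCoeff q y w := by
  have hr : 0 < Real.sqrt q := Real.sqrt_pos.2 hq
  have hq2 : Real.sqrt q ^ (2 : ℤ) = q := by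
    rw [zpow_ofNat, Real.sq_sqrt hq.le]
  have hlen : 1 ≤ len y := by
    rw [Nat.one_le_iff_ne_zero]
    exact mt len_eq_zero.1 hy
  unfold valueT explicitCoeff
  rw [if_neg hy, neg_mul, Finset.mul_sum]
  congr 1
  refine Finset.sum_congr rfl fun k hk => ?_
  rw [Finset.mem_Icc] at hk
  have hpow : ((Real.sqrt q)⁻¹ : ℝ) ^ ((len y : ℤ) + 1 - 2 * k) =
      Real.sqrt q ^ (len y - 1) * q ^ ((k : ℤ) - len y) := by
    have e : q ^ ((k : ℤ) - len y) = Real.sqrt q ^ (2 * ((k : ℤ) - len y)) := by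
      rw [_root_.zpow_mul, hq2]
    rw [e, ← zpow_natCast, ← zpow_add₀ hr.ne', _root_.inv_zpow', Nat.cast_sub hlen]
    congr 1
    push_cast
    ring
  have hu2 : ((Real.sqrt q)⁻¹ : ℝ) ^ 2 = q⁻¹ := by
    rw [inv_pow, Real.sq_sqrt hq.le]
  have hval (J : ℕ) : (-q⁻¹) ^ J / (1 + q⁻¹) = (-1) ^ J * q ^ (-(J : ℤ) + 1) / (1 + q) := by
    rw [neg_pow, zpow_add₀ hq.ne', _root_.zpow_neg, zpow_natCast, zpow_one, inv_pow]
    field_simp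
    ring
  have hst : StartsWith w (wordProd ((redWord y).take k)) ↔ (k : ℤ) ≤ (pos y).sign * pos w := by
    rw [startsWith_iff, pos_wordProd_take y hk.2]
    rcases sign_pos hy with h | h <;> rw [h] <;> omega
  rw [hpow, hu2, mul_assoc, hval]
  simp only [hst]
  congr 2
  unfold threshold
  split_ifs with h1 h2
  · rfl
  · rw [max_eq_right (by omega), show -((len w + 1 : ℕ) : ℤ) + 1 = -(len w : ℤ) by push_cast; ring]
  · rw [max_eq_left (by omega)]

/-! ### The Iwahori-Bruhat decomposition of `SL₂(F)` -/

section Matrices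

variable {F : Type*} [Field F]

/-- The matrix of determinant one with the given entries. -/
def mkSL (a b c d : F) (h : a * d - b * c = 1) : SL(2, F) :=
  ⟨!![a, b; c, d], by rw [det_fin_two_of, h]⟩

theorem det_eq (g : SL(2, F)) : g 0 0 * g 1 1 - g 0 1 * g 1 0 = 1 := by
  rw [← det_fin_two]
  exact g.2

theorem lift_r (ϖ : Fˣ) (n : ℤ) :
    (lift ϖ (.r n) : Matrix (Fin 2) (Fin 2) F) = !![(ϖ : F) ^ n, 0; 0, ((ϖ : F) ^ n)⁻¹] := by
  ext i j
  fin_cases i <;> fin_cases j <;> simp [lift, torus]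

theorem lift_sr (ϖ : Fˣ) (n : ℤ) :
    (lift ϖ (.sr n) : Matrix (Fin 2) (Fin 2) F) = !![0, -((ϖ : F) ^ n)⁻¹; (ϖ : F) ^ n, 0] := by
  change ((weylElt * torus (ϖ ^ n) : SL(2, F)) : Matrix (Fin 2) (Fin 2) F) = _
  rw [Matrix.SpecialLinearGroup.coe_mul]
  ext i j
  fin_cases i <;> fin_cases j <;> simp [torus, weylElt]

end Matrices

section Group

variable {F : Type*} [Field F] [ValuativeRel F]

theorem mem_maxCompact_iff {g : SL(2, F)} :
    g ∈ maxCompact F ↔ ∀ i j, valuation F (g i j) ≤ 1 := by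
  constructor
  · rintro ⟨k, rfl⟩ i j
    exact (k i j).2
  · intro h
    let A : Matrix (Fin 2) (Fin 2) 𝒪[F] := fun i j => ⟨g i j, h i j⟩
    have hA : A.map (algebraMap 𝒪[F] F) = g.1 := by
      ext i j
      rfl
    have hdet : A.det = 1 := by
      apply Subtype.coe_injective
      change algebraMap 𝒪[F] F A.det = 1
      rw [RingHom.map_det, RingHom.mapMatrix_apply, hA]
      exact g.2
    refine ⟨⟨A, hdet⟩, ?_⟩
    ext i j
    rfl

theorem mem_maximalIdeal_iff {x : 𝒪[F]} : x ∈ 𝓂[F] ↔ valuation F (x : F) < 1 := by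
  rw [IsLocalRing.mem_maximalIdeal, mem_nonunits_iff,
    (Valuation.integer.integers (valuation F)).isUnit_iff_valuation_eq_one]
  exact (lt_iff_le_and_ne.trans (and_iff_right x.2)).symm

theorem mem_iwahori_iff {g : SL(2, F)} :
    g ∈ iwahori F ↔ (∀ i j, valuation F (g i j) ≤ 1) ∧ valuation F (g 1 0) < 1 := by
  constructor
  · rintro ⟨k, hk, rfl⟩
    exact ⟨fun i j => (k i j).2, mem_maximalIdeal_iff.1 hk⟩
  · rintro ⟨h, h'⟩
    obtain ⟨k, rfl⟩ := mem_maxCompact_iff.2 h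
    exact ⟨k, mem_maximalIdeal_iff.2 h', rfl⟩

theorem iwahori_le_maxCompact : iwahori F ≤ maxCompact F :=
  fun _ hg => mem_maxCompact_iff.2 (mem_iwahori_iff.1 hg).1

theorem mkSL_mem_iwahori {a b c d : F} (h : a * d - b * c = 1) (ha : valuation F a ≤ 1)
    (hb : valuation F b ≤ 1) (hc : valuation F c < 1) (hd : valuation F d ≤ 1) :
    mkSL a b c d h ∈ iwahori F := by
  refine mem_iwahori_iff.2 ⟨fun i j => ?_, hc⟩
  fin_cases i <;> fin_cases j
  · exact ha
  · exact hb
  · exact hc.le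
  · exact hd

/-- The diagonal entries of an element of the Iwahori subgroup are units. -/
theorem valuation_diag_of_mem_iwahori {g : SL(2, F)} (hg : g ∈ iwahori F) :
    valuation F (g 0 0) = 1 ∧ valuation F (g 1 1) = 1 := by
  obtain ⟨h, h'⟩ := mem_iwahori_iff.1 hg
  have h1 : valuation F (g 0 1 * g 1 0) < 1 := by
    rw [map_mul]
    exact (mul_le_of_le_one_left' (h 0 1)).trans_lt h'
  have h2 : valuation F (g 0 0 * g 1 1) = 1 := by
    rw [show g 0 0 * g 1 1 = 1 + g 0 1 * g 1 0 by linear_combination det_eq g]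
    have := Valuation.map_add_eq_of_lt_right (v := valuation F) (x := g 0 1 * g 1 0) (y := 1)
      (by rwa [map_one])
    rw [add_comm, this, map_one]
  rw [map_mul] at h2
  constructor
  · refine le_antisymm (h 0 0) ?_
    rw [← h2]
    exact mul_le_of_le_one_right' (h 1 1)
  · refine le_antisymm (h 1 1) ?_
    rw [← h2]
    exact mul_le_of_le_one_left' (h 0 0)

theorem mem_iwahoriCell_iff (ϖ : Fˣ) (w : AffineWeyl) (g : SL(2, F)) :
    g ∈ iwahoriCell ϖ w ↔ ∃ k ∈ iwahori F, ∃ k' ∈ iwahori F, g = k * lift ϖ w * k' :=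
  DoubleCoset.mem_doubleCoset

theorem mul_mem_iwahoriCell {ϖ : Fˣ} {w : AffineWeyl} {u v g : SL(2, F)} (hu : u ∈ iwahori F)
    (hv : v ∈ iwahori F) (hg : g ∈ iwahoriCell ϖ w) : u * g * v ∈ iwahoriCell ϖ w := by
  rw [mem_iwahoriCell_iff] at *
  obtain ⟨k, hk, k', hk', rfl⟩ := hg
  exact ⟨u * k, mul_mem hu hk, k' * v, mul_mem hk' hv, by group⟩

theorem mem_iwahoriCell_r (ϖ : Fˣ) (n : ℤ) {k k' g : SL(2, F)} (hk : k ∈ iwahori F)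
    (hk' : k' ∈ iwahori F)
    (h00 : g 0 0 = k 0 0 * (ϖ : F) ^ n * k' 0 0 + k 0 1 * ((ϖ : F) ^ n)⁻¹ * k' 1 0)
    (h01 : g 0 1 = k 0 0 * (ϖ : F) ^ n * k' 0 1 + k 0 1 * ((ϖ : F) ^ n)⁻¹ * k' 1 1)
    (h10 : g 1 0 = k 1 0 * (ϖ : F) ^ n * k' 0 0 + k 1 1 * ((ϖ : F) ^ n)⁻¹ * k' 1 0)
    (h11 : g 1 1 = k 1 0 * (ϖ : F) ^ n * k' 0 1 + k 1 1 * ((ϖ : F) ^ n)⁻¹ * k' 1 1) :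
    g ∈ iwahoriCell ϖ (.r n) := by
  refine (mem_iwahoriCell_iff _ _ _).2 ⟨k, hk, k', hk', ?_⟩
  ext i j
  rw [Matrix.SpecialLinearGroup.coe_mul, Matrix.SpecialLinearGroup.coe_mul, lift_r]
  fin_cases i <;> fin_cases j <;>
    simp [Matrix.mul_apply, Fin.sum_univ_two, h00, h01, h10, h11]

theorem mem_iwahoriCell_sr (ϖ : Fˣ) (n : ℤ) {k k' g : SL(2, F)} (hk : k ∈ iwahori F)
    (hk' : k' ∈ iwahori F)
    (h00 : g 0 0 = k 0 1 * (ϖ : F) ^ n * k' 0 0 - k 0 0 * ((ϖ : F) ^ n)⁻¹ * k' 1 0)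
    (h01 : g 0 1 = k 0 1 * (ϖ : F) ^ n * k' 0 1 - k 0 0 * ((ϖ : F) ^ n)⁻¹ * k' 1 1)
    (h10 : g 1 0 = k 1 1 * (ϖ : F) ^ n * k' 0 0 - k 1 0 * ((ϖ : F) ^ n)⁻¹ * k' 1 0)
    (h11 : g 1 1 = k 1 1 * (ϖ : F) ^ n * k' 0 1 - k 1 0 * ((ϖ : F) ^ n)⁻¹ * k' 1 1) :
    g ∈ iwahoriCell ϖ (.sr n) := by
  refine (mem_iwahoriCell_iff _ _ _).2 ⟨k, hk, k', hk', ?_⟩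
  ext i j
  rw [Matrix.SpecialLinearGroup.coe_mul, Matrix.SpecialLinearGroup.coe_mul, lift_sr]
  fin_cases i <;> fin_cases j <;>
    simp [Matrix.mul_apply, Fin.sum_univ_two, h00, h01, h10, h11, sub_eq_add_neg]

theorem valuation_uniformizer_lt_one {ϖ : Fˣ} (hϖ : IsUniformizer ϖ) : valuation F (ϖ : F) < 1 := by
  obtain ⟨h, hirr⟩ := hϖ
  exact (Valuation.integer.integers (valuation F)).valuation_irreducible_lt_one hirr

theorem valuation_uniformizer_pos (ϖ : Fˣ) : 0 < valuation F (ϖ : F) :=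
  zero_lt_iff.2 ((valuation F).ne_zero_iff.2 ϖ.ne_zero)

/-- The double cosets `I w I` are disjoint. -/
theorem eq_of_mem_iwahoriCell {ϖ : Fˣ} (hϖ : IsUniformizer ϖ) {g : SL(2, F)} {w w' : AffineWeyl}
    (h : g ∈ iwahoriCell ϖ w) (h' : g ∈ iwahoriCell ϖ w') : w = w' := by
  have hϖ0 := valuation_uniformizer_pos ϖ
  have hϖ1 := valuation_uniformizer_lt_one hϖ
  set v := valuation F with hv
  have hlt {m n : ℤ} : v (ϖ : F) ^ m < v (ϖ : F) ^ n ↔ n < m :=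
    zpow_lt_zpow_iff_right_of_lt_one₀ hϖ0 hϖ1
  have hle {m n : ℤ} : v (ϖ : F) ^ m ≤ v (ϖ : F) ^ n ↔ n ≤ m :=
    zpow_le_zpow_iff_right_of_lt_one₀ hϖ0 hϖ1
  have heq {m n : ℤ} (h : v (ϖ : F) ^ m = v (ϖ : F) ^ n) : m = n :=
    le_antisymm (hle.1 h.ge) (hle.1 h.le)
  have hpos (n : ℤ) : 0 < v (ϖ : F) ^ n := zpow_pos hϖ0 n
  -- Two decompositions of g become k·w' = w·k' with k, k' in I, whose entries can be compared using
  -- that diagonal entries of I are units.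
  have key : ∀ w w', ∀ g ∈ iwahoriCell ϖ w, g ∈ iwahoriCell ϖ w' → ∃ k ∈ iwahori F,
      ∃ k' ∈ iwahori F, ∀ i j, (k * lift ϖ w') i j = (lift ϖ w * k') i j := by
    intro w w' g h h'
    obtain ⟨k, hk, k₁, hk₁, rfl⟩ := (mem_iwahoriCell_iff _ _ _).1 h
    obtain ⟨m, hm, m₁, hm₁, h2⟩ := (mem_iwahoriCell_iff _ _ _).1 h'
    refine ⟨k⁻¹ * m, mul_mem (inv_mem hk) hm, k₁ * m₁⁻¹, mul_mem hk₁ (inv_mem hm₁), ?_⟩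
    have : k⁻¹ * m * lift ϖ w' = lift ϖ w * (k₁ * m₁⁻¹) := by
      rw [show k⁻¹ * m * lift ϖ w' = k⁻¹ * (m * lift ϖ w' * m₁) * m₁⁻¹ by group, ← h2]
      group
    rw [this]
    intros
    rfl
  -- The lower left entry gives n < m because it lies in the maximal ideal on I; the upper right
  -- entry gives m ≤ n.
  have mixed : ∀ m n : ℤ, ∀ g ∈ iwahoriCell ϖ (.sr m), g ∉ iwahoriCell ϖ (.r n) := by
    intro m n g h h'
    obtain ⟨k, hk, k', hk', e⟩ := key _ _ g h h'
    obtain ⟨d0, d1⟩ := valuation_diag_of_mem_iwahori hk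
    obtain ⟨d0', d1'⟩ := valuation_diag_of_mem_iwahori hk'
    have hk1 := (mem_iwahori_iff.1 hk).1
    simp only [Matrix.SpecialLinearGroup.coe_mul, lift_r, lift_sr, Matrix.mul_apply,
      Fin.sum_univ_two] at e
    have e1 := congrArg v (e 1 0)
    have e2 := congrArg v (e 0 1)
    simp at e1 e2
    rw [d0', mul_one] at e1
    rw [d1', mul_one] at e2
    have h1 : v (ϖ : F) ^ m < v (ϖ : F) ^ n := by
      rw [← e1]
      exact mul_lt_of_lt_one_left (hpos n) (mem_iwahori_iff.1 hk).2
    have h2 : v (ϖ : F) ^ (-m) ≤ v (ϖ : F) ^ (-n) := by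
      rw [_root_.zpow_neg, _root_.zpow_neg, ← e2]
      exact mul_le_of_le_one_left' (hk1 0 1)
    have := hlt.1 h1
    have := hle.1 h2
    omega
  obtain ⟨n, rfl⟩ | ⟨n, rfl⟩ := r_or_sr w <;> obtain ⟨m, rfl⟩ | ⟨m, rfl⟩ := r_or_sr w'
  · obtain ⟨k, hk, k', hk', e⟩ := key _ _ g h h'
    simp only [Matrix.SpecialLinearGroup.coe_mul, lift_r, Matrix.mul_apply, Fin.sum_univ_two] at e
    have e1 := congrArg v (e 0 0)
    simp at e1
    rw [(valuation_diag_of_mem_iwahori hk).1, (valuation_diag_of_mem_iwahori hk').1, one_mul,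
      mul_one] at e1
    rw [heq e1]
  · exact absurd h (mixed _ _ g h')
  · exact absurd h' (mixed _ _ g h)
  · obtain ⟨k, hk, k', hk', e⟩ := key _ _ g h h'
    simp only [Matrix.SpecialLinearGroup.coe_mul, lift_sr, Matrix.mul_apply, Fin.sum_univ_two] at e
    have e1 := congrArg v (e 1 0)
    simp at e1
    rw [(valuation_diag_of_mem_iwahori hk).2, (valuation_diag_of_mem_iwahori hk').1, one_mul,
      mul_one] at e1
    rw [heq e1]

end Group

section LocalField

variable {F : Type*} [Field F] [ValuativeRel F] [TopologicalSpace F] [IsNonarchimedeanLocalField F]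
  {ϖ : Fˣ}

theorem exists_valuation_eq_zpow (hϖ : IsUniformizer ϖ) {x : F} (hx : x ≠ 0) :
    ∃ n : ℤ, valuation F x = valuation F (ϖ : F) ^ n := by
  obtain ⟨h, hirr⟩ := hϖ
  have key : ∀ x : F, x ≠ 0 → valuation F x ≤ 1 →
      ∃ n : ℕ, valuation F x = valuation F (ϖ : F) ^ n := by
    intro x hx hx1
    obtain ⟨n, u, hu⟩ := IsDiscreteValuationRing.eq_unit_mul_pow_irreducible
      (R := 𝒪[F]) (x := ⟨x, hx1⟩) (fun h => hx (congrArg Subtype.val h)) hirr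
    refine ⟨n, ?_⟩
    have h1 := congrArg Subtype.val hu
    have h2 : valuation F ((u : 𝒪[F]) : F) = 1 :=
      (Valuation.integer.integers (valuation F)).valuation_unit u
    change x = (u : 𝒪[F]) * (ϖ : F) ^ n at h1
    rw [h1, map_mul, map_pow, h2, one_mul]
  rcases le_total (valuation F x) 1 with h1 | h1
  · obtain ⟨n, hn⟩ := key x hx h1
    exact ⟨n, by rw [hn, zpow_natCast]⟩
  · obtain ⟨n, hn⟩ := key x⁻¹ (inv_ne_zero hx) (by
      rw [map_inv₀]
      exact inv_le_one_of_one_le₀ h1)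
    refine ⟨-n, ?_⟩
    rw [_root_.zpow_neg, zpow_natCast, ← hn, map_inv₀, inv_inv]

/-- Every element of `SL₂(F)` lies in a double coset `I w I`. -/
theorem exists_mem_iwahoriCell (hϖ : IsUniformizer ϖ) (g : SL(2, F)) :
    ∃ w, g ∈ iwahoriCell ϖ w := by
  obtain ⟨a, ha⟩ : ∃ a, a = g 0 0 := ⟨_, rfl⟩
  obtain ⟨b, hb⟩ : ∃ b, b = g 0 1 := ⟨_, rfl⟩
  obtain ⟨c, hc⟩ : ∃ c, c = g 1 0 := ⟨_, rfl⟩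
  obtain ⟨d, hd⟩ : ∃ d, d = g 1 1 := ⟨_, rfl⟩
  have hdet := det_eq g
  rw [← ha, ← hb, ← hc, ← hd] at hdet
  set v := valuation F with hv
  have hpow (n : ℤ) : (ϖ : F) ^ n ≠ 0 := zpow_ne_zero _ ϖ.ne_zero
  have hvdiv {x y : F} (hy : y ≠ 0) (h : v x ≤ v y) : v (x / y) ≤ 1 := by
    rw [map_div₀]
    exact div_le_one_of_le₀ h zero_le
  have hvdiv' {x y : F} (hy : y ≠ 0) (h : v x < v y) : v (x / y) < 1 := by
    rw [map_div₀]
    exact (div_lt_one₀ (zero_lt_iff.2 (v.ne_zero_iff.2 hy))).2 h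
  have hvone {x : F} (hx : x ≠ 0) {n : ℤ} (h : v x = v (ϖ : F) ^ n) : v (x / (ϖ : F) ^ n) = 1 := by
    rw [map_div₀, map_zpow₀, ← h, div_self (v.ne_zero_iff.2 hx)]
  have hvone' {x : F} (hx : x ≠ 0) {n : ℤ} (h : v x = v (ϖ : F) ^ n) :
      v ((ϖ : F) ^ n / x) = 1 := by
    rw [← inv_div, map_inv₀, hvone hx h, inv_one]
  have hvinv {x y : F} (hy : y ≠ 0) {n : ℤ} (h : v y⁻¹ = v (ϖ : F) ^ n) :
      v (x * (ϖ : F) ^ n) = v (x / y) := by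
    rw [map_mul, map_zpow₀, ← h, ← map_mul, div_eq_mul_inv]
  have hle {x y : F} (h : v x ≤ v y) (hy : y = 0) : x = 0 := by
    rw [hy, map_zero, le_zero_iff] at h
    exact v.zero_iff.1 h
  have hv0 : v 0 ≤ 1 := by simp
  have hv0' : v 0 < 1 := by simp
  have hv1 : v 1 ≤ 1 := by simp
  -- A dominant entry serves as pivot and the others are cleared by elements of I. Lower left
  -- entries of I lie in the maximal ideal, so c wins ties with a and d, b must beat them strictly,
  -- and a diagonal pivot must beat c strictly but may tie with b.
  by_cases hcp : v a ≤ v c ∧ v d ≤ v c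
  · obtain ⟨h1, h2⟩ := hcp
    have hc0 : c ≠ 0 := fun h0 => by
      rw [hle h1 h0, h0] at hdet
      simp at hdet
    obtain ⟨n, hn⟩ := exists_valuation_eq_zpow hϖ hc0
    have hP := hpow n
    refine ⟨_, mem_iwahoriCell_sr ϖ n
      (k := mkSL 1 (a / c) 0 1 (by ring)) (k' := mkSL (c / (ϖ : F) ^ n) (d / (ϖ : F) ^ n) 0
        ((ϖ : F) ^ n / c) (by field_simp; ring))
      (mkSL_mem_iwahori _ hv1 (hvdiv hc0 h1) hv0' hv1)
      (mkSL_mem_iwahori _ (hvone hc0 hn).le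
        (by rw [map_div₀, map_zpow₀, ← hn, ← map_div₀]; exact hvdiv hc0 h2) hv0'
        (hvone' hc0 hn).le) ?_ ?_ ?_ ?_⟩
    · rw [← ha]; simp [mkSL]; field_simp
    · rw [← hb]; simp [mkSL]; field_simp; linear_combination -hdet
    · rw [← hc]; simp [mkSL]; field_simp
    · rw [← hd]; simp [mkSL]; field_simp
  by_cases hbp : v a < v b ∧ v d < v b
  · obtain ⟨h1, h2⟩ := hbp
    have hb0 : b ≠ 0 := fun h0 => by
      rw [h0, map_zero] at h1
      exact absurd h1 (not_lt.2 zero_le)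
    obtain ⟨n, hn⟩ := exists_valuation_eq_zpow hϖ (inv_ne_zero hb0)
    have hP := hpow n
    refine ⟨_, mem_iwahoriCell_sr ϖ n
      (k := mkSL 1 0 (d / b) 1 (by ring)) (k' := mkSL (-(b⁻¹ / (ϖ : F) ^ n)) 0 (-(a * (ϖ : F) ^ n))
        (-((ϖ : F) ^ n / b⁻¹)) (by field_simp; ring))
      (mkSL_mem_iwahori _ hv1 hv0 (hvdiv' hb0 h2) hv1)
      (mkSL_mem_iwahori _ (by rw [Valuation.map_neg]; exact (hvone (inv_ne_zero hb0) hn).le) hv0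
        (by rw [Valuation.map_neg, hvinv hb0 hn]; exact hvdiv' hb0 h1)
        (by rw [Valuation.map_neg]; exact (hvone' (inv_ne_zero hb0) hn).le)) ?_ ?_ ?_ ?_⟩
    · rw [← ha]; simp [mkSL]; field_simp
    · rw [← hb]; simp [mkSL]; field_simp
    · rw [← hc]; simp [mkSL]; field_simp; linear_combination -hdet
    · rw [← hd]; simp [mkSL]; field_simp
  have hor : (v c < v a ∧ v b ≤ v a) ∨ (v c < v d ∧ v b ≤ v d) := by
    rw [not_and_or, not_le, not_le] at hcp
    rw [not_and_or, not_lt, not_lt] at hbp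
    rcases le_total (v a) (v d) with h | h
    · refine Or.inr ⟨?_, ?_⟩
      · rcases hcp with h' | h'
        · exact h'.trans_le h
        · exact h'
      · rcases hbp with h' | h'
        · exact h'.trans h
        · exact h'
    · refine Or.inl ⟨?_, ?_⟩
      · rcases hcp with h' | h'
        · exact h'
        · exact h'.trans_le h
      · rcases hbp with h' | h'
        · exact h'
        · exact h'.trans h
  rcases hor with ⟨h1, h2⟩ | ⟨h1, h2⟩
  · have ha0 : a ≠ 0 := fun h0 => by
      rw [h0, map_zero] at h1
      exact absurd h1 (not_lt.2 zero_le)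
    obtain ⟨n, hn⟩ := exists_valuation_eq_zpow hϖ ha0
    have hP := hpow n
    refine ⟨_, mem_iwahoriCell_r ϖ n
      (k := mkSL 1 0 (c / a) 1 (by ring)) (k' := mkSL (a / (ϖ : F) ^ n) (b / (ϖ : F) ^ n) 0
        ((ϖ : F) ^ n / a) (by field_simp; ring))
      (mkSL_mem_iwahori _ hv1 hv0 (hvdiv' ha0 h1) hv1)
      (mkSL_mem_iwahori _ (hvone ha0 hn).le
        (by rw [map_div₀, map_zpow₀, ← hn, ← map_div₀]; exact hvdiv ha0 h2) hv0'
        (hvone' ha0 hn).le) ?_ ?_ ?_ ?_⟩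
    · rw [← ha]; simp [mkSL]; field_simp
    · rw [← hb]; simp [mkSL]; field_simp
    · rw [← hc]; simp [mkSL]; field_simp
    · rw [← hd]; simp [mkSL]; field_simp; linear_combination hdet
  · have hd0 : d ≠ 0 := fun h0 => by
      rw [h0, map_zero] at h1
      exact absurd h1 (not_lt.2 zero_le)
    obtain ⟨n, hn⟩ := exists_valuation_eq_zpow hϖ (inv_ne_zero hd0)
    have hP := hpow n
    refine ⟨_, mem_iwahoriCell_r ϖ n
      (k := mkSL 1 (b / d) 0 1 (by ring)) (k' := mkSL (d⁻¹ / (ϖ : F) ^ n) 0 (c * (ϖ : F) ^ n)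
        ((ϖ : F) ^ n / d⁻¹) (by field_simp; ring))
      (mkSL_mem_iwahori _ hv1 (hvdiv hd0 h2) hv0' hv1)
      (mkSL_mem_iwahori _ (hvone (inv_ne_zero hd0) hn).le hv0
        (by rw [hvinv hd0 hn]; exact hvdiv' hd0 h1)
        (hvone' (inv_ne_zero hd0) hn).le) ?_ ?_ ?_ ?_⟩
    · rw [← ha]; simp [mkSL]; field_simp; linear_combination hdet
    · rw [← hb]; simp [mkSL]; field_simp
    · rw [← hc]; simp [mkSL]; field_simp
    · rw [← hd]; simp [mkSL]; field_simp

end LocalField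

/-! ### Estimates on double cosets -/

section Estimates

theorem continuous_entry {F : Type*} [Field F] [TopologicalSpace F] (i j : Fin 2) : Continuous fun g : SL(2, F) => g i j :=
  (continuous_apply j).comp ((continuous_apply i).comp continuous_subtype_val)

variable {F : Type*} [Field F] [ValuativeRel F]

/-- The exponent `n` with `I w I ⊆ K diag(ϖ^n, ϖ^{-n}) K`. -/
def cartanExponent : AffineWeyl → ℕ
  | .r n => (show ℤ from n).natAbs
  | .sr n => (show ℤ from n).natAbs

theorem two_mul_cartanExponent_le (w : AffineWeyl) : 2 * cartanExponent w ≤ len w + 1 := by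
  rw [len_eq]
  obtain ⟨n, rfl⟩ | ⟨n, rfl⟩ := r_or_sr w
  · change 2 * n.natAbs ≤ (2 * n).natAbs + 1
    omega
  · change 2 * n.natAbs ≤ (1 - 2 * n).natAbs + 1
    omega

theorem weylElt_mem_maxCompact : (weylElt : SL(2, F)) ∈ maxCompact F := by
  refine mem_maxCompact_iff.2 fun i j => ?_
  fin_cases i <;> fin_cases j <;> simp [weylElt]

theorem torus_zpow_mem_doubleCoset (ϖ : Fˣ) (n : ℤ) :
    torus (ϖ ^ n) ∈ DoubleCoset.doubleCoset (torus (ϖ ^ n.natAbs)) (maxCompact F : Set SL(2, F))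
      (maxCompact F) := by
  rw [DoubleCoset.mem_doubleCoset]
  rcases le_total 0 n with h | h
  · refine ⟨1, one_mem _, 1, one_mem _, ?_⟩
    rw [one_mul, mul_one, ← zpow_natCast, Int.natAbs_of_nonneg h]
  · refine ⟨weylElt, weylElt_mem_maxCompact, weylElt⁻¹, inv_mem weylElt_mem_maxCompact, ?_⟩
    obtain ⟨m, rfl⟩ : ∃ m : ℕ, n = -(m : ℤ) := ⟨n.natAbs, by omega⟩
    rw [eq_mul_inv_iff_mul_eq, Int.natAbs_neg, Int.natAbs_natCast]
    ext i j
    rw [Matrix.SpecialLinearGroup.coe_mul, Matrix.SpecialLinearGroup.coe_mul]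
    fin_cases i <;> fin_cases j <;> simp [torus, weylElt]

theorem lift_mem_doubleCoset (ϖ : Fˣ) (w : AffineWeyl) :
    lift ϖ w ∈ DoubleCoset.doubleCoset (torus (ϖ ^ cartanExponent w))
      (maxCompact F : Set SL(2, F)) (maxCompact F) := by
  obtain ⟨n, rfl⟩ | ⟨n, rfl⟩ := r_or_sr w
  · exact torus_zpow_mem_doubleCoset ϖ n
  · obtain ⟨k, hk, k', hk', h⟩ := DoubleCoset.mem_doubleCoset.1 (torus_zpow_mem_doubleCoset ϖ n)
    refine DoubleCoset.mem_doubleCoset.2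
      ⟨weylElt * k, mul_mem weylElt_mem_maxCompact hk, k', hk', ?_⟩
    change weylElt * torus (ϖ ^ n) = weylElt * k * torus (ϖ ^ n.natAbs) * k'
    rw [h]
    group

theorem iwahoriCell_subset (ϖ : Fˣ) (w : AffineWeyl) :
    iwahoriCell ϖ w ⊆ DoubleCoset.doubleCoset (torus (ϖ ^ cartanExponent w))
      (maxCompact F : Set SL(2, F)) (maxCompact F) := by
  intro g hg
  obtain ⟨k, hk, k', hk', rfl⟩ := (mem_iwahoriCell_iff _ _ _).1 hg
  obtain ⟨m, hm, m', hm', h⟩ := DoubleCoset.mem_doubleCoset.1 (lift_mem_doubleCoset ϖ w)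
  refine DoubleCoset.mem_doubleCoset.2 ⟨k * m, mul_mem (iwahori_le_maxCompact hk) hm, m' * k',
    mul_mem hm' (iwahori_le_maxCompact hk'), ?_⟩
  rw [h]
  group

/-- Only this upper bound on Δ is needed, not the disjointness of the K-double cosets. -/
theorem cartan_le {ϖ : Fˣ} {w : AffineWeyl} {g : SL(2, F)} (hg : g ∈ iwahoriCell ϖ w) :
    cartan ϖ g ≤ cartanExponent w := Nat.sInf_le (iwahoriCell_subset ϖ w hg)

theorem valuation_entry_le {ϖ : Fˣ} (hϖ : IsUniformizer ϖ) {w : AffineWeyl} {g : SL(2, F)}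
    (hg : g ∈ iwahoriCell ϖ w) (i j : Fin 2) :
    valuation F ((ϖ : F) ^ cartanExponent w * g i j) ≤ 1 := by
  obtain ⟨k, hk, k', hk', rfl⟩ := DoubleCoset.mem_doubleCoset.1 (iwahoriCell_subset ϖ w hg)
  set n := cartanExponent w
  have h1 := mem_maxCompact_iff.1 hk
  have h2 := mem_maxCompact_iff.1 hk'
  have hϖn : valuation F ((ϖ : F) ^ n) ≤ 1 := by
    rw [map_pow]
    exact pow_le_one₀ zero_le (valuation_uniformizer_lt_one hϖ).le
  have e : (ϖ : F) ^ n * (k * torus (ϖ ^ n) * k') i j =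
      (ϖ : F) ^ n * (ϖ : F) ^ n * (k i 0 * k' 0 j) + k i 1 * k' 1 j := by
    rw [Matrix.SpecialLinearGroup.coe_mul, Matrix.SpecialLinearGroup.coe_mul]
    simp [Matrix.mul_apply, Fin.sum_univ_two, torus]
    field_simp
  rw [e]
  refine (Valuation.map_add _ _ _).trans (max_le ?_ ?_)
  · simp only [map_mul] at *
    exact mul_le_one' (mul_le_one' hϖn hϖn) (mul_le_one' (h1 _ _) (h2 _ _))
  · rw [map_mul]
    exact mul_le_one' (h1 _ _) (h2 _ _)

theorem iwahori_eq : (iwahori F : Set SL(2, F)) =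
    (⋂ i, ⋂ j, (fun g : SL(2, F) => g i j) ⁻¹' (𝒪[F] : Set F)) ∩
      (fun g : SL(2, F) => g 1 0) ⁻¹' {x : F | valuation F x < 1} := by
  ext g
  simp only [SetLike.mem_coe, mem_iwahori_iff, Set.mem_inter_iff, Set.mem_iInter,
    Set.mem_preimage]
  rfl

end Estimates

/-! ### Growth of polynomial functions and of the absolute value -/

section Polynomials

variable {F : Type*} [Field F] [ValuativeRel F] [TopologicalSpace F] [IsNonarchimedeanLocalField F]
  {ϖ : Fˣ}

/-- A polynomial function grows at most polynomially in the size of the entries. -/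
theorem exists_valuation_eval_le (hϖ : IsUniformizer ϖ) (p : MvPolynomial (Fin 2 × Fin 2) F) :
    ∃ D : ℕ, ∀ (n : ℕ) (e : Fin 2 × Fin 2 → F), (∀ ij, valuation F ((ϖ : F) ^ n * e ij) ≤ 1) →
      valuation F ((ϖ : F) ^ (D * (n + 1)) * MvPolynomial.eval e p) ≤ 1 := by
  have hϖ1 (n : ℕ) : valuation F ((ϖ : F) ^ n) ≤ 1 := by
    rw [map_pow]
    exact pow_le_one₀ zero_le (valuation_uniformizer_lt_one hϖ).le
  have mono {m n : ℕ} {x : F} (hmn : m ≤ n) (h : valuation F ((ϖ : F) ^ m * x) ≤ 1) :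
      valuation F ((ϖ : F) ^ n * x) ≤ 1 := by
    obtain ⟨d, rfl⟩ := Nat.exists_eq_add_of_le hmn
    rw [pow_add, show (ϖ : F) ^ m * (ϖ : F) ^ d * x = (ϖ : F) ^ d * ((ϖ : F) ^ m * x) by ring,
      map_mul]
    exact mul_le_one' (hϖ1 d) h
  induction p using MvPolynomial.induction_on with
  | C a =>
    obtain ⟨D, hD⟩ : ∃ D : ℕ, valuation F ((ϖ : F) ^ D * a) ≤ 1 := by
      by_cases ha : a = 0
      · exact ⟨0, by simp [ha]⟩
      · obtain ⟨m, hm⟩ := exists_valuation_eq_zpow hϖ ha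
        refine ⟨m.natAbs, ?_⟩
        rw [map_mul, hm, map_pow, ← zpow_natCast,
          ← zpow_add₀ (valuation_uniformizer_pos ϖ).ne']
        obtain ⟨d, hd⟩ : ∃ d : ℕ, (m.natAbs : ℤ) + m = d := ⟨((m.natAbs : ℤ) + m).toNat, by omega⟩
        rw [hd, zpow_natCast, ← map_pow]
        exact hϖ1 d
    refine ⟨D, fun n e _ => ?_⟩
    rw [MvPolynomial.eval_C]
    -- The factor n + 1 instead of n leaves room for constants when n = 0.
    exact mono (Nat.le_mul_of_pos_right D (Nat.succ_pos n)) hD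
  | add p q hp hq =>
    obtain ⟨D, hD⟩ := hp
    obtain ⟨E, hE⟩ := hq
    refine ⟨D + E, fun n e he => ?_⟩
    rw [map_add, mul_add]
    refine (Valuation.map_add _ _ _).trans (max_le ?_ ?_)
    · exact mono (Nat.mul_le_mul_right _ (Nat.le_add_right D E)) (hD n e he)
    · exact mono (Nat.mul_le_mul_right _ (Nat.le_add_left E D)) (hE n e he)
  | mul_X p ij hp =>
    obtain ⟨D, hD⟩ := hp
    refine ⟨D + 1, fun n e he => ?_⟩
    rw [map_mul (MvPolynomial.eval e), MvPolynomial.eval_X, add_one_mul, ← add_assoc, pow_add, pow_add, pow_one,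
      show (ϖ : F) ^ (D * (n + 1)) * (ϖ : F) ^ n * ϖ * (MvPolynomial.eval e p * e ij) =
        ϖ * (((ϖ : F) ^ (D * (n + 1)) * MvPolynomial.eval e p) * ((ϖ : F) ^ n * e ij)) by ring,
      map_mul, map_mul]
    exact mul_le_one' (valuation_uniformizer_lt_one hϖ).le (mul_le_one' (hD n e he) (he ij))

variable (F) in
theorem one_lt_resCard : (1 : ℝ) < resCard F := by
  unfold resCard
  exact_mod_cast Finite.one_lt_card

/-- The absolute value is bounded on `ϖ^{-N} 𝒪` by the `N`-th power of a constant. -/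
theorem exists_absF_le (hϖ : IsUniformizer ϖ) :
    ∃ M : ℝ, 1 ≤ M ∧ ∀ (N : ℕ) (x : F), valuation F ((ϖ : F) ^ N * x) ≤ 1 → absF x ≤ M ^ N := by
  have hq := one_lt_resCard F
  set iso := IsNonarchimedeanLocalField.valueGroupWithZeroIsoInt F with hiso
  have hne {x : F} (hx : x ≠ 0) : iso (valuation F x) ≠ 0 := by
    rw [map_ne_zero]
    exact (valuation F).ne_zero_iff.2 hx
  have hlog {x : F} (hx : x ≠ 0) (h : valuation F x ≤ 1) :
      WithZero.log (iso (valuation F x)) ≤ 0 := by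
    have h1 : iso (valuation F x) ≤ 1 := by
      rw [← map_one iso]
      exact (map_le_map_iff iso).2 h
    have := (WithZero.log_le_log (hne hx) one_ne_zero).2 h1
    rwa [WithZero.log_one] at this
  have hϖlog := hlog ϖ.ne_zero (valuation_uniformizer_lt_one hϖ).le
  -- The constant is |ϖ|⁻¹; it suffices that it is at least 1.
  refine ⟨(resCard F : ℝ) ^ (-WithZero.log (iso (valuation F (ϖ : F)))),
    one_le_zpow₀ hq.le (by omega), fun N x h => ?_⟩
  unfold absF
  split_ifs with hx
  · exact pow_nonneg (zpow_nonneg (by linarith) _) _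
  · rw [← zpow_natCast, ← _root_.zpow_mul]
    apply zpow_le_zpow_right₀ hq.le
    have h1 := hlog (mul_ne_zero (pow_ne_zero N ϖ.ne_zero) hx) h
    rw [map_mul, map_mul, map_pow, map_pow,
      WithZero.log_mul (pow_ne_zero _ (hne ϖ.ne_zero)) (hne hx), WithZero.log_pow,
      nsmul_eq_mul] at h1
    linarith

theorem absF_nonneg (x : F) : 0 ≤ absF x := by
  unfold absF
  split_ifs
  · exact le_rfl
  · exact zpow_nonneg (by have := one_lt_resCard F; linarith) _

/-! ### The Iwahori subgroup is open and compact -/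

theorem isClopen_valuation_lt_one : IsClopen {x : F | valuation F x < 1} := by
  have := (valuation F).isClopen_ball (1 : MonoidWithZeroHom.ValueGroup₀ (.ofClass (valuation F)))
  simpa only [Valuation.restrict_lt_one_iff] using this

theorem isClopen_iwahori : IsClopen (iwahori F : Set SL(2, F)) := by
  rw [iwahori_eq]
  refine IsClopen.inter ?_ (isClopen_valuation_lt_one.preimage (continuous_entry 1 0))
  exact isClopen_iInter_of_finite fun i => isClopen_iInter_of_finite fun j =>
    (valuation F).isClopen_integer.preimage (continuous_entry i j)

/-- The closed ball of radius zero is {0}. Points being closed makes SL₂(F) closed in the matrices,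
as needed for compactness. -/
theorem t1Space_localField : T1Space F := by
  refine IsTopologicalAddGroup.t1Space F ?_
  have := (valuation F).isClosed_closedBall
    (0 : MonoidWithZeroHom.ValueGroup₀ (.ofClass (valuation F)))
  convert! this using 1
  ext x
  simp

theorem isCompact_iwahori : IsCompact (iwahori F : Set SL(2, F)) := by
  have h𝒪 : IsCompact (𝒪[F] : Set F) := IsNonarchimedeanLocalField.isCompact_closedBall F 1
  have hK : IsCompact {A : Matrix (Fin 2) (Fin 2) F | ∀ i, A i ∈ {v : Fin 2 → F | ∀ j, v j ∈ 𝒪[F]}} :=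
    isCompact_pi_infinite fun _ => isCompact_pi_infinite fun _ => h𝒪
  have := t1Space_localField (F := F)
  have hpre := (Matrix.SpecialLinearGroup.isClosedEmbedding_val (n := Fin 2)
    (R := F)).isCompact_preimage hK
  refine hpre.of_isClosed_subset isClopen_iwahori.isClosed ?_
  intro g hg i j
  exact (mem_iwahori_iff.1 hg).1 i j

end Polynomials

/-! ### The function represented by `t_y` -/

section Function

variable {F : Type*} [Field F] [ValuativeRel F] [TopologicalSpace F] [IsNonarchimedeanLocalField F]
  {ϖ : Fˣ}

variable (F) in
theorem inv_sqrt_resCard_pos : 0 < (Real.sqrt (resCard F))⁻¹ :=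
  inv_pos.2 (Real.sqrt_pos.2 (zero_lt_one.trans (one_lt_resCard F)))

variable (F) in
theorem inv_sqrt_resCard_lt_one : (Real.sqrt (resCard F))⁻¹ < 1 :=
  inv_lt_one_of_one_lt₀ (Real.lt_sqrt_of_sq_lt (by simpa using one_lt_resCard F))

theorem represents_preimageT_iff (ϖ : Fˣ) (y : AffineWeyl) (f : SL(2, F) → ℂ) :
    Represents ϖ (preimageT y) f ↔
      ∀ w, ∀ g ∈ iwahoriCell ϖ w, f g = (valueT (Real.sqrt (resCard F))⁻¹ y w : ℂ) := by
  have h (w : AffineWeyl) : HasSum (fun k : ℤ => (tCoeff (preimageT y) w k : ℂ) *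
      (((Real.sqrt (resCard F))⁻¹ : ℝ) : ℂ) ^ k)
      (valueT (Real.sqrt (resCard F))⁻¹ y w : ℂ) := by
    have h1 := (hasValue_preimageT (inv_sqrt_resCard_pos F) (inv_sqrt_resCard_lt_one F) y w).hasSum
    convert! Complex.hasSum_ofReal.2 h1 using 2 with k
    push_cast
    rfl
  constructor
  · intro hf w g hg
    exact (hf w g hg).unique (h w)
  · intro hf w g hg
    rw [hf w g hg]
    exact h w

/-- Powers of a linear function grow more slowly than an exponential. -/
theorem exists_rpow_le_mul_pow {q : ℝ} (hq : 1 < q) (A m : ℝ) (hA : 0 ≤ A) (hm : 0 < m) :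
    ∃ C : ℝ, 0 ≤ C ∧ ∀ (n : ℕ) (x : ℝ), 0 ≤ x → x ≤ A * (n + 1) → x ^ m ≤ C * q ^ n := by
  obtain ⟨k, hk⟩ := exists_nat_ge m
  obtain ⟨B, hB⟩ := (tendsto_pow_const_div_const_pow_of_one_lt k hq).bddAbove_range
  have hB' (n : ℕ) : (n : ℝ) ^ k ≤ B * q ^ n := by
    rw [← div_le_iff₀ (pow_pos (by linarith) n)]
    exact hB ⟨n, rfl⟩
  have hB0 : 0 ≤ B := by
    have := hB' 1
    rw [Nat.cast_one, one_pow, pow_one] at this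
    by_contra hc
    nlinarith
  -- Replacing A by A + 1 makes the base at least 1, so that m may be raised to the integer k; the
  -- extra q comes from n + 1.
  refine ⟨(A + 1) ^ k * (B * q), mul_nonneg (by positivity) (mul_nonneg hB0 (by linarith)),
    fun n x hx hxA => ?_⟩
  have hn : (0 : ℝ) ≤ n := Nat.cast_nonneg n
  have h1 : (1 : ℝ) ≤ (A + 1) * (n + 1) := by nlinarith [mul_nonneg hA hn]
  calc x ^ m ≤ ((A + 1) * (n + 1)) ^ m := Real.rpow_le_rpow hx (by nlinarith) hm.le
    _ ≤ ((A + 1) * (n + 1)) ^ (k : ℝ) := Real.rpow_le_rpow_of_exponent_le h1 hk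
    _ = (A + 1) ^ k * ((n + 1 : ℕ) : ℝ) ^ k := by
        rw [Real.rpow_natCast, mul_pow]
        push_cast
        rfl
    _ ≤ (A + 1) ^ k * (B * q ^ (n + 1)) :=
        mul_le_mul_of_nonneg_left (hB' (n + 1)) (by positivity)
    _ = (A + 1) ^ k * (B * q) * q ^ n := by ring

theorem isSchwartz_of_represents (hϖ : IsUniformizer ϖ) {y : AffineWeyl} {f : SL(2, F) → ℂ}
    (hf : ∀ w, ∀ g ∈ iwahoriCell ϖ w, f g = (valueT (Real.sqrt (resCard F))⁻¹ y w : ℂ))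
    (hinv : ∀ u ∈ iwahori F, ∀ v ∈ iwahori F, ∀ g, f (u * g * v) = f g) : IsSchwartz ϖ f := by
  refine ⟨⟨iwahori F, isClopen_iwahori.isOpen, isCompact_iwahori, hinv⟩, fun p m hm => ?_⟩
  have hq := one_lt_resCard F
  obtain ⟨C, hC, hvalue⟩ := exists_abs_valueT_le (inv_sqrt_resCard_pos F)
    (inv_sqrt_resCard_lt_one F) y
  rw [inv_pow, Real.sq_sqrt (zero_le_one.trans hq.le)] at hvalue
  obtain ⟨D, hD⟩ := exists_valuation_eval_le hϖ p
  obtain ⟨M, hM, habs⟩ := exists_absF_le hϖ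
  have hlogM : 0 ≤ Real.log M := Real.log_nonneg hM
  obtain ⟨B, hB0, hB⟩ := exists_rpow_le_mul_pow hq (Real.log 2 + D * Real.log M) m
    (add_nonneg (Real.log_nonneg one_le_two) (mul_nonneg (Nat.cast_nonneg D) hlogM)) hm
  refine ⟨C * resCard F * B, fun g => ?_⟩
  obtain ⟨w, hw⟩ := exists_mem_iwahoriCell hϖ g
  set n := cartanExponent w with hn
  set q : ℝ := ((resCard F : ℕ) : ℝ) with hqdef
  have hq0 : 0 < q := zero_lt_one.trans hq
  have h1 : cartanDelta ϖ g ≤ q ^ n := pow_le_pow_right₀ hq.le (cartan_le hw)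
  have h2 : ‖f g‖ ≤ C * (q⁻¹) ^ len w := by
    rw [hf w g hw, Complex.norm_real, Real.norm_eq_abs]
    exact hvalue w
  have h3 : absF (polyFun p g) ≤ M ^ (D * (n + 1)) :=
    habs _ _ (hD n _ fun ij => valuation_entry_le hϖ hw ij.1 ij.2)
  have hp0 := absF_nonneg (polyFun p g)
  have hMpow : 1 ≤ M ^ (D * (n + 1)) := one_le_pow₀ hM
  have h4 : Real.log (1 + absF (polyFun p g)) ≤ (Real.log 2 + D * Real.log M) * (n + 1) := by
    calc Real.log (1 + absF (polyFun p g)) ≤ Real.log (2 * M ^ (D * (n + 1))) :=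
          Real.log_le_log (by linarith) (by linarith)
      _ = Real.log 2 + D * (n + 1) * Real.log M := by
          rw [Real.log_mul two_ne_zero (by positivity), Real.log_pow]
          push_cast
          rfl
      _ ≤ _ := by
          have := mul_nonneg (Real.log_nonneg one_le_two) (Nat.cast_nonneg (α := ℝ) n)
          nlinarith
  have h5 := hB n _ (Real.log_nonneg (by linarith)) h4
  -- One factor q^n bounds Δ and the other pays for the power of the logarithm; the decay q^{-ℓ(w)}
  -- absorbs both since 2n ≤ ℓ(w) + 1.
  have h6 : q ^ n * (q⁻¹) ^ len w * q ^ n ≤ q := by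
    have h7 : q ^ (2 * n) ≤ q ^ (len w + 1) :=
      pow_le_pow_right₀ hq.le (two_mul_cartanExponent_le w)
    have h8 : q ^ n * (q⁻¹) ^ len w * q ^ n = q ^ (2 * n) / q ^ len w := by
      rw [inv_pow, two_mul, pow_add]
      ring
    rw [h8, div_le_iff₀ (pow_pos hq0 _), ← pow_succ']
    exact h7
  calc cartanDelta ϖ g * ‖f g‖ * Real.log (1 + absF (polyFun p g)) ^ m
      ≤ q ^ n * (C * (q⁻¹) ^ len w) * (B * q ^ n) := by
        refine mul_le_mul (mul_le_mul h1 h2 (norm_nonneg _) (by positivity)) h5 ?_ (by positivity)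
        exact Real.rpow_nonneg (Real.log_nonneg (by linarith)) _
    _ = C * B * (q ^ n * (q⁻¹) ^ len w * q ^ n) := by ring
    _ ≤ C * B * q := mul_le_mul_of_nonneg_left h6 (mul_nonneg hC hB0)
    _ = C * q * B := by ring

end Function

end AsymptoticHecke

end

/-! ### The theorem -/

open AsymptoticHecke in
theorem mainTheorem8 (F : Type*) [Field F] [ValuativeRel F] [TopologicalSpace F]
    [IsNonarchimedeanLocalField F] (ϖ : Fˣ) (hϖ : IsUniformizer ϖ) (y : AffineWeyl) :
    (∃! a, IsPreimageT y a) ∧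
    ∀ a, IsPreimageT y a →
      (∃! f : SL(2, F) → ℂ, Represents ϖ a f) ∧
      ∀ f : SL(2, F) → ℂ, Represents ϖ a f →
        (y ≠ 1 → ∀ w, ∀ g ∈ iwahoriCell ϖ w, f g = (explicitCoeff (resCard F) y w : ℂ)) ∧
        (∀ u ∈ iwahori F, ∀ v ∈ iwahori F, ∀ g, f (u * g * v) = f g) ∧
        IsSchwartz ϖ f := by
  refine ⟨⟨preimageT y, (isPreimageT_iff y _).2 rfl, fun a ha => (isPreimageT_iff y a).1 ha⟩, ?_⟩
  intro a ha
  obtain rfl := (isPreimageT_iff y a).1 ha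
  simp only [represents_preimageT_iff]
  choose cell hcell using fun g : SL(2, F) => exists_mem_iwahoriCell hϖ g
  refine ⟨⟨fun g => (valueT (Real.sqrt (resCard F))⁻¹ y (cell g) : ℂ), ?_, ?_⟩, ?_⟩
  · intro w g hg
    rw [eq_of_mem_iwahoriCell hϖ hg (hcell g)]
  · intro f hf
    funext g
    exact hf _ g (hcell g)
  · intro f hf
    have hinv : ∀ u ∈ iwahori F, ∀ v ∈ iwahori F, ∀ g, f (u * g * v) = f g := by
      intro u hu v hv g
      rw [hf _ g (hcell g), hf _ _ (mul_mem_iwahoriCell hu hv (hcell g))]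
    refine ⟨fun hy w g hg => ?_, hinv, isSchwartz_of_represents hϖ hf hinv⟩
    rw [hf w g hg, valueT_eq_explicitCoeff (zero_lt_one.trans (one_lt_resCard F)) hy]
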